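/- **Setting.** Let $I^*$ be a proper ideal on a set $\kappa$, $\bar\lambda=\langle\lambda_i:i<\kappa\rangle$ a sequence of cardinals, $\theta$ a cardinal. For an ideal $J$ on $\kappa$ and $f,g\in\prod\bar\lambda=\prod_{i<\kappa}\lambda_i$, $f<_Jg$ means $\{i:\neg f(i)<g(i)\}\in J$; similarly for $\le_J$, and for filters (via the dual filter of an ideal). $\prod\bar\lambda/J$ is $\mu$-directed if every set of fewer than $\mu$ members has a $\le_J$-upper bound in $\prod\bar\lambda$. $\mathrm{tcf}(\prod\bar\lambda/J)$, the true cofinality, is the least cardinal $\mu$ for which there is a $<_J$-increasing, $\le_J$-cofinal sequence of length $\mu$ in $\prod\bar\lambda$ (it exists for ultrafilters and regular $\bar\lambda$). $\prod(\bar\lambda\restriction B)/J$ is the product over $i\in B$ modulo the restriction of $J$ to $B$. Put $$\mathrm{pcf}(\bar\lambda)=\{\mathrm{tcf}(\textstyle\prod\bar\lambda/D): D\text{ an ultrafilter on }\kappa\text{ disjoint to }I^*\},$$ let $J_{<\mu}$ be the ideal of those $B\subseteq\kappa$ that belong to no ultrafilter $D$ disjoint to $I^*$ with $\mathrm{tcf}(\prod\bar\lambda/D)\ge\mu$,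 and $J_{\le\mu}=J_{<\mu^+}$. $J+\mathcal B$ is the ideal generated by $J\cup\mathcal B$. $\mathrm{wsat}(I^*)$ is the least cardinal $\sigma\geq 1$ such that $\kappa$ cannot be divided into $\sigma$ pairwise disjoint sets not in $I^*$, and $\liminf_{I^*}\bar\lambda=\min\{\mu:\{i:\lambda_i\le\mu\}\notin I^*\}$. Assumption $(*)$: every $\lambda_i$ is a regular (infinite) cardinal and either $(\alpha)$ $\lambda_i>\theta\ge\mathrm{wsat}(I^*)$ for all $i$, or $(\beta)$ $\liminf_{I^*}\bar\lambda\ge\theta\ge\mathrm{wsat}(I^*)$ and $\prod\bar\lambda/I^*$ is $\theta^+$-directed. **Variants of the pcf theorem** for $(\bar\lambda,\theta)$. Each of them requires that $\prod\bar\lambda/I^*$ is $\theta$-directed. The first three require that $\prod\bar\lambda/J_{<\lambda}$ is $\lambda$-directed for every cardinal $\lambda$, the last one requires it for every $\lambda\ge\theta$. In addition: * *pcf theorem*: there are $B_\lambda\subseteq\kappa$ ($\lambda\in\mathrm{pcf}(\bar\lambda)$) with $J_{<\lambda}=I^*+\{B_\mu:\mu\in\mathrm{pcf}(\bar\lambda),\mu<\lambda\}$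 for every cardinal $\lambda$ and, for every $\lambda\in\mathrm{pcf}(\bar\lambda)$, $B_\lambda\notin J_{<\lambda}$, $\mathrm{tcf}(\prod(\bar\lambda\restriction B_\lambda)/J_{<\lambda})=\lambda$ and $J_{\le\lambda}=J_{<\lambda}+\{B_\lambda\}$. * *weak pcf theorem*: there are $B_{\lambda,\alpha}\subseteq\kappa$ ($\alpha<\lambda\in\mathrm{pcf}(\bar\lambda)$) with $B_{\lambda,\alpha}\setminus B_{\lambda,\beta}\in J_{<\lambda}$ for $\alpha<\beta<\lambda\in\mathrm{pcf}(\bar\lambda)$, with $J_{<\lambda}=I^*+\{B_{\mu,\alpha}:\alpha<\mu<\lambda,\ \mu\in\mathrm{pcf}(\bar\lambda)\}$ for every cardinal $\lambda$, and with $\mathrm{tcf}(\prod(\bar\lambda\restriction B_{\lambda,\alpha})/J_{<\lambda})=\lambda$ for $\alpha<\lambda\in\mathrm{pcf}(\bar\lambda)$. * *weaker pcf theorem*: for every ultrafilter $D$ on $\kappa$ disjoint to $J_{<\theta}$, with $\lambda=\mathrm{tcf}(\prod\bar\lambda/D)$, one has $\lambda\ge\theta$ and there is $B\in D\cap J_{\le\lambda}\setminus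 J_{<\lambda}$ with $\mathrm{tcf}(\prod(\bar\lambda\restriction B)/J_{<\lambda})=\lambda$. * *weakest pcf theorem*: nothing more. **Continuity conditions.** For a regular cardinal $\sigma>\theta+1$, a $(\sigma,\theta)$-continuity condition is a sequence $\langle a_\alpha:\alpha<\sigma\rangle$ for which there is an unbounded $S\subseteq\sigma$ without two successive members, such that for all $\alpha<\sigma$: $a_\alpha\subseteq\alpha$, $\mathrm{otp}(a_\alpha)<\theta+1$ and $a_\beta=a_\alpha\cap\beta$ for $\beta\in a_\alpha$; and for every club $E$ of $\sigma$ there is $\delta\in S$ such that the set of those $\alpha\in a_\delta$ with $\mathrm{otp}(a_\alpha)<\theta$ and $(\beta,\alpha)\cap E\ne\emptyset$ for all $\beta\in a_\delta\cap\alpha$ has order type $\theta$. **Claim.** 1. If $(*)$ holds, then $I^*$ satisfies the weak pcf theorem for $(\bar\lambda,\theta^+)$. 2. If $(*)$ holds and moreover $\theta^+<\lambda_i$ for all $i$, or just $\prod\bar\lambda/I^*$ is $\theta^{++}$-directed, or there is a $(\theta^+,\theta)$-continuity condition, then $I^*$ satisfies the pcf theorem for $(\bar\lambda,\theta^+)$.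 3. If all $\lambda_i$ are regular, then for $(\bar\lambda,\theta)$ the pcf theorem implies the weak pcf theorem, which implies the weaker pcf theorem, which implies the weakest pcf theorem. -/

import Mathlib

open Cardinal Set

universe u

namespace PcfTh

noncomputable section

variable {ι : Type u}

/-! ### Reduced products of cardinals

`lam : ι → Cardinal` is the sequence of cardinals, the ideals are ideals of subsets of `ι`, and
orders modulo an ideal are orders modulo the dual filter. -/

/-- The product `∏ lam`: functions `f` with `f i` an ordinal below `lam i` for every `i`. -/
abbrev Product (lam : ι → Cardinal.{u}) : Type u := ∀ i, (lam i).ord.ToType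

/-- The filter dual to an ideal of sets: `A` belongs to it iff `Aᶜ` belongs to the ideal. -/
def dual (J : Order.Ideal (Set ι)) : Filter ι :=
  Filter.comk (fun A => A ∈ J)
    (by
      obtain ⟨A, hA⟩ := J.nonempty
      exact J.lower (Set.empty_subset A) hA)
    (fun _ hA _ hB => J.lower hB hA)
    (fun _ hA _ hB => Order.Ideal.sup_mem hA hB)

/-- `f < g` modulo the filter `F`. -/
def ModLT (F : Filter ι) {lam : ι → Cardinal.{u}} (f g : Product lam) : Prop :=
  ∀ᶠ i in F, f i < g i

/-- `f ≤ g` modulo the filter `F`. -/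
def ModLE (F : Filter ι) {lam : ι → Cardinal.{u}} (f g : Product lam) : Prop :=
  ∀ᶠ i in F, f i ≤ g i

/-- `∏ lam / F` is `μ`-directed: every set of fewer than `μ` members has an upper bound. -/
def Directed (F : Filter ι) (lam : ι → Cardinal.{u}) (μ : Cardinal.{u}) : Prop :=
  ∀ A : Set (Product lam), #A < μ → ∃ g : Product lam, ∀ f ∈ A, ModLE F f g

/-- The lengths `μ` for which `∏ lam / F` has a strictly increasing cofinal sequence
`⟨p α : α < μ⟩`. -/
def scaleLengths (F : Filter ι) (lam : ι → Cardinal.{u}) : Set Cardinal.{u} :=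
  {μ | ∃ p : μ.ord.ToType → Product lam,
    (∀ α β, α < β → ModLT F (p α) (p β)) ∧ ∀ q : Product lam, ∃ α, ModLE F q (p α)}

/-- `tcf (∏ lam / F)`, the least length of a strictly increasing cofinal sequence. Such a
sequence exists for every ultrafilter and regular `lam`, the product being then linearly
ordered. -/
def tcf (F : Filter ι) (lam : ι → Cardinal.{u}) : Cardinal.{u} :=
  sInf (scaleLengths F lam)

/-- `∏ lam / F` has true cofinality `μ` (in particular the true cofinality exists). -/
def HasTcf (F : Filter ι) (lam : ι → Cardinal.{u}) (μ : Cardinal.{u}) : Prop :=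
  IsLeast (scaleLengths F lam) μ

/-- `∏ (lam ↾ B)` modulo (the restriction to `B` of) the ideal `J` has true cofinality `μ`. -/
def HasTcfOn (J : Order.Ideal (Set ι)) (lam : ι → Cardinal.{u}) (B : Set ι)
    (μ : Cardinal.{u}) : Prop :=
  HasTcf ((dual J).comap (Subtype.val : B → ι)) (fun i : B => lam i) μ

/-! ### Ideals -/

/-- The ultrafilter `D` is disjoint to the ideal `I`. -/
def DisjointTo (D : Ultrafilter ι) (I : Order.Ideal (Set ι)) : Prop :=
  ∀ A ∈ I, A ∉ D

/-- `pcf(lam)`: the true cofinalities of ultraproducts by ultrafilters disjoint to `I`. -/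
def pcf (I : Order.Ideal (Set ι)) (lam : ι → Cardinal.{u}) : Set Cardinal.{u} :=
  {μ | ∃ D : Ultrafilter ι, DisjointTo D I ∧ tcf (D : Filter ι) lam = μ}

/-- The ideal `J_{<μ}[lam]` (not necessarily proper): the sets `B` that belong to no ultrafilter
`D` disjoint to `I` with `tcf (∏ lam / D) ≥ μ`. -/
def J (I : Order.Ideal (Set ι)) (lam : ι → Cardinal.{u}) (μ : Cardinal.{u}) :
    Order.Ideal (Set ι) where
  carrier := {B | ¬ ∃ D : Ultrafilter ι, DisjointTo D I ∧ B ∈ D ∧ μ ≤ tcf (D : Filter ι) lam}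
  lower' := by
    rintro A B hBA hA ⟨D, hD, hBD, hμ⟩
    exact hA ⟨D, hD, Filter.mem_of_superset hBD hBA, hμ⟩
  nonempty' := ⟨∅, by
    rintro ⟨D, -, h, -⟩
    exact Ultrafilter.empty_notMem h⟩
  directed' := by
    intro A hA B hB
    refine ⟨A ∪ B, ?_, Set.subset_union_left, Set.subset_union_right⟩
    rintro ⟨D, hD, h, hμ⟩
    rcases Ultrafilter.union_mem_iff.1 h with h | h
    · exact hA ⟨D, hD, h, hμ⟩
    · exact hB ⟨D, hD, h, hμ⟩

/-- `J_{≤μ}[lam] = J_{<μ⁺}[lam]`. -/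
def Jle (I : Order.Ideal (Set ι)) (lam : ι → Cardinal.{u}) (μ : Cardinal.{u}) :
    Order.Ideal (Set ι) :=
  J I lam (Order.succ μ)

/-- `I + 𝓑`, the ideal generated by `I` and the family `𝓑`: the sets covered, up to a member of
`I`, by finitely many members of `𝓑`. -/
def plus (I : Order.Ideal (Set ι)) (𝓑 : Set (Set ι)) : Order.Ideal (Set ι) where
  carrier := {A | ∃ s : Set (Set ι), s.Finite ∧ s ⊆ 𝓑 ∧ A \ ⋃₀ s ∈ I}
  lower' := by
    rintro A B hBA ⟨s, hs, hs𝓑, hA⟩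
    exact ⟨s, hs, hs𝓑, I.lower (Set.sdiff_subset_sdiff_left hBA) hA⟩
  nonempty' := by
    obtain ⟨A, hA⟩ := I.nonempty
    exact ⟨A, ∅, Set.finite_empty, Set.empty_subset _, I.lower Set.sdiff_subset hA⟩
  directed' := by
    rintro A ⟨s, hs, hs𝓑, hA⟩ B ⟨t, ht, ht𝓑, hB⟩
    refine ⟨A ∪ B, ⟨s ∪ t, hs.union ht, Set.union_subset hs𝓑 ht𝓑, ?_⟩,
      Set.subset_union_left, Set.subset_union_right⟩
    refine I.lower ?_ (Order.Ideal.sup_mem hA hB)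
    rintro i ⟨hi | hi, hn⟩
    · exact Or.inl ⟨hi, fun h => hn (Set.sUnion_mono Set.subset_union_left h)⟩
    · exact Or.inr ⟨hi, fun h => hn (Set.sUnion_mono Set.subset_union_right h)⟩

/-- `I` is `θ`-weakly saturated: the index set cannot be divided into `θ` pairwise disjoint
`I`-positive sets. -/
def WeaklySaturated (I : Order.Ideal (Set ι)) (θ : Cardinal.{u}) : Prop :=
  ¬ ∃ (T : Type u) (A : T → Set ι), #T = θ ∧ (∀ s t, s ≠ t → Disjoint (A s) (A t)) ∧
    (⋃ t, A t) = Set.univ ∧ ∀ t, A t ∉ I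

/-- `wsat(I)`, the least nonzero `θ` for which `I` is `θ`-weakly saturated (`θ = 0` would qualify
for a trivial reason). -/
def wsat (I : Order.Ideal (Set ι)) : Cardinal.{u} :=
  sInf {θ | θ ≠ 0 ∧ WeaklySaturated I θ}

/-- `lim inf_I lam = min {μ : {i : lam i ≤ μ} ∉ I}`. -/
def liminf (I : Order.Ideal (Set ι)) (lam : ι → Cardinal.{u}) : Cardinal.{u} :=
  sInf {μ | {i | lam i ≤ μ} ∉ I}

/-- The basic assumption: `lam` is a sequence of regular cardinals and either
`min lam > θ ≥ wsat(I)`, or `lim inf_I lam ≥ θ ≥ wsat(I)` and `∏ lam / I` is `θ⁺`-directed. -/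
def BasicAssumption (I : Order.Ideal (Set ι)) (lam : ι → Cardinal.{u}) (θ : Cardinal.{u}) :
    Prop :=
  (∀ i, (lam i).IsRegular) ∧
    (((∀ i, θ < lam i) ∧ wsat I ≤ θ) ∨
      (θ ≤ liminf I lam ∧ wsat I ≤ θ ∧ Directed (dual I) lam (Order.succ θ)))

/-! ### The variants of the pcf theorem -/

/-- `I` satisfies the pcf theorem for `(lam, θ)`. -/
def PcfTheorem (I : Order.Ideal (Set ι)) (lam : ι → Cardinal.{u}) (θ : Cardinal.{u}) : Prop :=
  Directed (dual I) lam θ ∧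
  (∀ μ, Directed (dual (J I lam μ)) lam μ) ∧
  ∃ B : Cardinal.{u} → Set ι,
    (∀ μ, J I lam μ = plus I {A | ∃ ν ∈ pcf I lam, ν < μ ∧ A = B ν}) ∧
    ∀ μ ∈ pcf I lam,
      B μ ∉ J I lam μ ∧
      HasTcfOn (J I lam μ) lam (B μ) μ ∧
      Jle I lam μ = plus (J I lam μ) {B μ}

/-- `I` satisfies the weak pcf theorem for `(lam, θ)`. -/
def WeakPcfTheorem (I : Order.Ideal (Set ι)) (lam : ι → Cardinal.{u}) (θ : Cardinal.{u}) :
    Prop :=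
  Directed (dual I) lam θ ∧
  (∀ μ, Directed (dual (J I lam μ)) lam μ) ∧
  ∃ B : (μ : Cardinal.{u}) → μ.ord.ToType → Set ι,
    (∀ μ ∈ pcf I lam, ∀ α β : μ.ord.ToType, α < β → B μ α \ B μ β ∈ J I lam μ) ∧
    (∀ μ, J I lam μ = plus I {A | ∃ ν ∈ pcf I lam, ν < μ ∧ ∃ α : ν.ord.ToType, A = B ν α}) ∧
    ∀ μ ∈ pcf I lam, ∀ α : μ.ord.ToType, HasTcfOn (J I lam μ) lam (B μ α) μ

/-- `I` satisfies the weaker pcf theorem for `(lam, θ)`. -/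
def WeakerPcfTheorem (I : Order.Ideal (Set ι)) (lam : ι → Cardinal.{u}) (θ : Cardinal.{u}) :
    Prop :=
  Directed (dual I) lam θ ∧
  (∀ μ, Directed (dual (J I lam μ)) lam μ) ∧
  ∀ D : Ultrafilter ι, DisjointTo D (J I lam θ) → ∀ μ, μ = tcf (D : Filter ι) lam →
    θ ≤ μ ∧ ∃ B ∈ D, B ∈ Jle I lam μ ∧ B ∉ J I lam μ ∧ HasTcfOn (J I lam μ) lam B μ

/-- `I` satisfies the weakest pcf theorem for `(lam, θ)`. -/
def WeakestPcfTheorem (I : Order.Ideal (Set ι)) (lam : ι → Cardinal.{u}) (θ : Cardinal.{u}) :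
    Prop :=
  Directed (dual I) lam θ ∧ ∀ μ, θ ≤ μ → Directed (dual (J I lam μ)) lam μ

/-! ### Continuity conditions -/

/-- The order type of a subset of a well-ordered type. -/
def otp {W : Type u} [LinearOrder W] [WellFoundedLT W] (s : Set W) : Ordinal.{u} :=
  Ordinal.type (fun x y : s => x < y)

/-- `a = ⟨a α : α < κ⟩` is an `(S, μ, θ)`-continuity condition, where `κ` is a regular cardinal,
`θ < μ < κ` (`μ` an ordinal), and `S` is an unbounded subset of `κ` without two successive
members. -/
structure IsContinuityCondition (κ : Cardinal.{u}) (S : Set κ.ord.ToType) (μ : Ordinal.{u})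
    (θ : Cardinal.{u}) (a : κ.ord.ToType → Set κ.ord.ToType) : Prop where
  regular : κ.IsRegular
  theta_lt : θ.ord < μ
  lt_kappa : μ < κ.ord
  unbounded : ∀ α, ∃ β ∈ S, α < β
  no_successive : ∀ α ∈ S, ∀ β ∈ S, ¬ α ⋖ β
  subset : ∀ α, a α ⊆ Set.Iio α
  otp_lt : ∀ α, otp (a α) < μ
  coherent : ∀ α, ∀ β ∈ a α, a β = a α ∩ Set.Iio β
  guesses : ∀ E : Set κ.ord.ToType, IsClub E → ∃ δ ∈ S,
    otp {α ∈ a δ | otp (a α) < θ.ord ∧ ¬ ∃ β ∈ a δ, β < α ∧ Set.Ioo β α ∩ E = ∅} = θ.ord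

/-- There is a `(κ, θ)`-continuity condition, i.e. an `(S, θ + 1, θ)`-continuity condition for
some unbounded `S ⊆ κ`. -/
def ExistsContinuityCondition (κ θ : Cardinal.{u}) : Prop :=
  ∃ (S : Set κ.ord.ToType) (a : κ.ord.ToType → Set κ.ord.ToType),
    IsContinuityCondition κ S (θ.ord + 1) θ a

end

end PcfTh

namespace PcfTh

/-! The assumption (∗) enters through `Basic`: one can take θ steps so that at almost every index a
given step lies below all later ones, whereas pairwise disjoint sets `W ζ`, ζ < θ, cannot all be
I-positive. Most existence statements follow from one diagonal argument. If the wanted object does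
not exist, each candidate is refuted modulo some ultrafilter. Take θ candidates, each above the
earlier refutations, and evaluate everything at one stage `α` beyond the θ stages involved, the
length being regular and above θ. The sets where one fixed function is caught between a candidate
and its refutation are pairwise disjoint, yet each belongs to an ultrafilter disjoint to I. This
gives directedness modulo J_{<μ} (`Basic.directed_J`), a sequence cofinal modulo every ultrafilter
of true cofinality μ (`Basic.exists_universal`), and a function `g` bounding it wherever it is
bounded (`Basic.exists_bounding`).

The sets {i : g i ≤ f α i} are then weak generators: modulo an ultrafilter that contains one of them
and is disjoint to J_{<μ}, `f` is unbounded, hence cofinal, and every ultrafilter of true cofinality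
μ contains one of them. Separation by ultrafilters turns this into the ideal equations
(`J_eq_plus`).

For genuine generators these sets must stabilise modulo J_{<μ} (`Basic.exists_stable`). If they did
not, θ successive increments would be disjoint, provided `f` increases pointwise along the chosen
stages, up to errors attached to single stages. Such an `f` exists when initial segments of
θ-sequences can be listed in advance (`Approachable`): for μ = θ⁺ by a continuity condition, for μ =
θ⁺⁺ by coherent approximations of size at most θ, and for larger regular μ by club guessing. -/

/-! ### Initial ordinals as well-ordered types -/

/-- The initial ordinal of `κ` as a well-ordered type. -/
abbrev Pt (κ : Cardinal.{u}) : Type u := κ.ord.ToType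

theorem card_Pt (κ : Cardinal.{u}) : #(Pt κ) = κ := by simp

theorem card_Iio_lt {κ : Cardinal.{u}} (a : Pt κ) : #(Iio a) < κ := by
  simpa using Cardinal.mk_Iio_lt a

theorem card_Iic_lt {κ : Cardinal.{u}} (hκ : ℵ₀ ≤ κ) (a : Pt κ) : #(Iic a) < κ := by
  rw [← Iio_insert]
  exact (mk_insert_le).trans_lt (add_lt_of_lt hκ (card_Iio_lt a) (one_lt_aleph0.trans_le hκ))

theorem exists_forall_lt {κ : Cardinal.{u}} (hκ : κ.IsRegular) {s : Set (Pt κ)} (hs : #s < κ) :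
    ∃ b, ∀ a ∈ s, a < b := by
  rw [← not_isCofinal_iff]
  intro h
  have := Order.cof_le h
  rw [Ordinal.cof_toType, hκ.cof_ord] at this
  exact this.not_gt hs

theorem exists_forall_lt_fun {κ : Cardinal.{u}} (hκ : κ.IsRegular) {X : Type u} (f : X → Pt κ)
    (hX : #X < κ) : ∃ b, ∀ x, f x < b := by
  obtain ⟨b, hb⟩ := exists_forall_lt hκ (s := range f) (mk_range_le.trans_lt hX)
  exact ⟨b, fun x => hb _ ⟨x, rfl⟩⟩

theorem nonempty_Pt {κ : Cardinal.{u}} (hκ : κ ≠ 0) : Nonempty (Pt κ) := by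
  rw [← mk_ne_zero_iff, card_Pt]; exact hκ

/-- The common form of all transfinite constructions below: it is enough that a next value exists,
whatever the earlier values were. -/
theorem exists_wf_rec {L X : Type*} [LinearOrder L] [WellFoundedLT L]
    (P : (l : L) → ((m : L) → m < l → X) → X → Prop) (h : ∀ l f, ∃ x, P l f x) :
    ∃ f : L → X, ∀ l, P l (fun m _ => f m) (f l) := by
  choose G hG using h
  refine ⟨wellFounded_lt.fix G, fun l => ?_⟩
  rw [WellFounded.fix_eq]
  exact hG _ _

/-- A sequence along a shorter index set that climbs faster than a given function. -/
theorem exists_climbing {κ : Cardinal.{u}} (hκ : κ.IsRegular) {X : Type u} [LinearOrder X]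
    [WellFoundedLT X] (hX : #X < κ) (s : Pt κ → Pt κ) :
    ∃ q : X → Pt κ, ∀ x y, x < y → q x < q y ∧ s (q x) < q y := by
  obtain ⟨q, hq⟩ := exists_wf_rec (L := X) (X := Pt κ)
    (fun l f b => ∀ m (h : m < l), f m h < b ∧ s (f m h) < b) (by
      intro l f
      have hl : #(Iio l) < κ := (mk_set_le _).trans_lt hX
      obtain ⟨b, hb⟩ := exists_forall_lt_fun hκ (fun m : Iio l => f m.1 m.2) hl
      obtain ⟨c, hc⟩ := exists_forall_lt_fun hκ (fun m : Iio l => s (f m.1 m.2)) hl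
      exact ⟨max b c, fun m h => ⟨(hb ⟨m, h⟩).trans_le (le_max_left _ _),
        (hc ⟨m, h⟩).trans_le (le_max_right _ _)⟩⟩)
  exact ⟨q, fun x y h => hq y x h⟩

/-- The point `i` is closed under the function `φ`. -/
def ClosedPt {L : Type*} [LT L] (φ : L → L) (i : L) : Prop := ∀ j < i, φ j < i

/-- Iterate ω times a map that jumps beyond the `φ`-values so far; the least strict bound of the
iterates is closed, and uncountable regularity makes one exist. -/
theorem exists_closedPt_gt {κ : Cardinal.{u}} (hκ : κ.IsRegular) (hκ' : ℵ₀ < κ)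
    (φ : Pt κ → Pt κ) (b : Pt κ) : ∃ i, b < i ∧ ClosedPt φ i := by
  have step : ∀ a : Pt κ, ∃ c, a < c ∧ ∀ j ≤ a, φ j < c := by
    intro a
    obtain ⟨c, hc⟩ := exists_forall_lt_fun hκ (fun j : Iic a => φ j) (card_Iic_lt hκ.1 a)
    obtain ⟨d, hd⟩ := exists_forall_lt hκ (s := {a}) (by simpa using one_lt_aleph0.trans hκ')
    exact ⟨max c d, (hd a rfl).trans_le (le_max_right _ _),
      fun j hj => (hc ⟨j, hj⟩).trans_le (le_max_left _ _)⟩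
  choose g hg hgφ using step
  let x : ℕ → Pt κ := fun n => g^[n] b
  have hx : ∀ n, x (n + 1) = g (x n) := fun n => Function.iterate_succ_apply' g n b
  obtain ⟨c, hc⟩ := exists_forall_lt hκ (s := range x)
    ((countable_range x).le_aleph0.trans_lt hκ')
  obtain ⟨i, hi, hmin⟩ := wellFounded_lt.has_min {c | ∀ n, x n < c} ⟨c, fun n => hc _ ⟨n, rfl⟩⟩
  refine ⟨i, hi 0, fun j hj => ?_⟩
  by_contra hcon
  have : ∃ n, j ≤ x n := by
    by_contra! h
    exact hmin j h hj
  obtain ⟨n, hn⟩ := this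
  refine hcon ((hgφ (x n) j hn).trans ?_)
  rw [← hx]; exact hi _

theorem exists_range_superset {κ : Cardinal.{u}} {Y : Type u} {s : Set Y} (hs : #s ≤ κ)
    [Nonempty Y] : ∃ F : Pt κ → Y, s ⊆ range F := by
  classical
  rw [← card_Pt κ, Cardinal.le_def] at hs
  obtain ⟨f⟩ := hs
  refine ⟨fun k => if h : ∃ y : s, f y = k then (h.choose : Y) else Classical.arbitrary Y, ?_⟩
  intro y hy
  refine ⟨f ⟨y, hy⟩, ?_⟩
  have h : ∃ z : s, f z = f ⟨y, hy⟩ := ⟨_, rfl⟩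
  simp only [h, dite_true]
  rw [f.injective h.choose_spec]

theorem isRegular_succ_succ {θ : Cardinal.{u}} (hθ : ℵ₀ ≤ θ) :
    (Order.succ (Order.succ θ)).IsRegular :=
  isRegular_succ (hθ.trans (Order.le_succ θ))

/-! ### Approachability -/

/-- The pair `λ, θ` is approachable: there are families `Q α` of fewer than `λ` sequences such
that every function has a climbing sequence of length `θ` all of whose initial segments were
listed in time. -/
def Approachable (lam θ : Cardinal.{u}) : Prop :=
  ∃ (T : Pt lam → Type u) (Q : ∀ α, T α → Pt θ → Pt lam), (∀ α, #(T α) < lam) ∧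
    ∀ s : Pt lam → Pt lam, ∃ (q : Pt θ → Pt lam) (e : Pt θ → Pt θ),
      (∀ ζ ξ, ζ < ξ → q ζ < q ξ ∧ s (q ζ) ≤ q ξ) ∧
      ∀ ξ, ∃ τ, ∀ ζ < ξ, Q (q ξ) τ (e ζ) = q ζ

theorem approachable_of_continuityCondition {θ : Cardinal.{u}}
    (h : ExistsContinuityCondition (Order.succ θ) θ) : Approachable (Order.succ θ) θ := by
  obtain ⟨S, a, h⟩ := h
  classical
  have hreg := h.regular
  have hθ : ℵ₀ ≤ θ := by
    by_contra! hlt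
    have h1 := hreg.1
    have h2 : Order.succ θ < ℵ₀ := by
      obtain ⟨n, rfl⟩ := lt_aleph0.1 hlt
      rw [succ_natCast]; exact_mod_cast natCast_lt_aleph0 (n := n + 1)
    exact h1.not_gt h2
  have hunc : ℵ₀ < Order.succ θ := Order.lt_succ_iff.2 hθ
  -- By coherence, a member `β` of `a α` is determined by the order type of `a β`.
  have otp_inj : ∀ α, ∀ β ∈ a α, ∀ γ ∈ a α, β < γ → otp (a β) < otp (a γ) := by
    intro α β hβ γ hγ hlt
    rw [h.coherent α β hβ, h.coherent α γ hγ]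
    have hβ' : β ∈ a α ∩ Iio γ := ⟨hβ, hlt⟩
    unfold otp
    refine Ordinal.type_lt_iff.2 ⟨⟨⟨⟨fun x => ⟨x.1, x.2.1, lt_trans x.2.2 hlt⟩, ?_⟩, ?_⟩,
      ⟨β, hβ'⟩, ?_⟩⟩
    · intro x y hxy
      exact Subtype.ext (congrArg (fun z => z.1) hxy)
    · rfl
    · rintro ⟨x, hx, hx'⟩
      constructor
      · rintro ⟨y, hy⟩
        have : y.1 = x := congrArg (fun z => z.1) hy
        show x < β
        rw [← this]; exact y.2.2
      · intro (hy : x < β)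
        exact ⟨⟨x, hx, hy⟩, rfl⟩
  -- One list per stage suffices, its entries named by order types. The fallback `α` is never
  -- consulted.
  refine ⟨fun _ => PUnit, fun α _ x =>
    if hx : ∃ β ∈ a α, otp (a β) = Ordinal.typein (α := Pt θ) (· < ·) x then hx.choose else α, ?_, ?_⟩
  · intro α
    simpa using one_lt_aleph0.trans hunc
  intro s
  obtain ⟨δ, -, hδ⟩ := h.guesses {i | ClosedPt s i} (by
    refine ⟨?_, ?_⟩
    · intro d hd hne _ x hx j hj
      obtain ⟨e, he, hje⟩ := (lt_isLUB_iff hx).1 hj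
      exact (hd he j hje).trans_le (hx.1 he)
    · intro b
      obtain ⟨i, hi, hi'⟩ := exists_closedPt_gt hreg hunc s b
      exact ⟨i, hi', hi.le⟩)
  set G := {α ∈ a δ | otp (a α) < θ.ord ∧
    ¬ ∃ β ∈ a δ, β < α ∧ Ioo β α ∩ {i | ClosedPt s i} = ∅} with hG
  have hiso : Ordinal.type (fun x y : Pt θ => x < y) = otp G := by
    rw [hδ]; exact Ordinal.type_toType _
  unfold otp at hiso
  obtain ⟨f⟩ := Ordinal.type_eq.1 hiso
  have hlt : ∀ x, otp (a (f x).1) < Ordinal.type (fun x y : Pt θ => x < y) := by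
    intro x
    exact ((f x).2.2.1).trans_eq (Ordinal.type_toType _).symm
  refine ⟨fun ζ => (f ζ).1, fun ζ => Ordinal.enum (· < ·) ⟨otp (a (f ζ).1), hlt ζ⟩, ?_, ?_⟩
  · intro ζ ξ hζξ
    have hlt : (f ζ).1 < (f ξ).1 := f.map_rel_iff.2 hζξ
    refine ⟨hlt, ?_⟩
    have := (f ξ).2.2.2
    have hne : (Ioo (f ζ).1 (f ξ).1 ∩ {i | ClosedPt s i}).Nonempty := by
      rw [nonempty_iff_ne_empty]
      intro he
      exact this ⟨_, (f ζ).2.1, hlt, he⟩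
    obtain ⟨i, hi, hi'⟩ := hne
    exact ((hi' _ hi.1).trans hi.2).le
  · intro ξ
    refine ⟨PUnit.unit, fun ζ hζ => ?_⟩
    have hlt' : (f ζ).1 < (f ξ).1 := f.map_rel_iff.2 hζ
    have hmem : (f ζ).1 ∈ a (f ξ).1 := by
      rw [h.coherent δ _ (f ξ).2.1]
      exact ⟨(f ζ).2.1, hlt'⟩
    have hex : ∃ β ∈ a (f ξ).1, otp (a β) =
        Ordinal.typein (α := Pt θ) (· < ·) (Ordinal.enum (· < ·) ⟨otp (a (f ζ).1), hlt ζ⟩) :=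
      ⟨_, hmem, (Ordinal.typein_enum _ _).symm⟩
    simp only [hex, dite_true]
    have h1 := hex.choose_spec.1
    have h2 := hex.choose_spec.2.trans (Ordinal.typein_enum _ _)
    rcases lt_trichotomy hex.choose (f ζ).1 with h3 | h3 | h3
    · exact absurd h2 (otp_inj _ _ h1 _ hmem h3).ne
    · exact h3
    · exact absurd h2 (otp_inj _ _ hmem _ h1 h3).ne'

theorem card_Iio_le_of_succ {κ : Cardinal.{u}} (δ : Pt (Order.succ κ)) : #(Iio δ) ≤ κ :=
  Order.lt_succ_iff.1 (card_Iio_lt δ)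

/-- Each δ < θ⁺⁺ is exhausted by sets `A ε δ`, ε < θ⁺, of size at most θ. At a suitable `ε` they
cohere below `δ`, so the rank `r ε` is injective on `A ε δ`. Guessing `ε` and a bound `ρ` on the
ranks, only θ⁺ guesses in all, recovers the members from codes below θ. -/
theorem approachable_succ_succ {θ : Cardinal.{u}} (hθ : ℵ₀ ≤ θ) :
    Approachable (Order.succ (Order.succ θ)) θ := by
  classical
  set K := Pt (Order.succ θ)
  set M := Pt (Order.succ (Order.succ θ))
  have hregK : (Order.succ θ).IsRegular := isRegular_succ hθ
  have hregM := isRegular_succ_succ hθ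
  have huncK : ℵ₀ < Order.succ θ := Order.lt_succ_iff.2 hθ
  have : Nonempty M := nonempty_Pt hregM.ne_zero
  have : Nonempty K := nonempty_Pt hregK.ne_zero
  have hF : ∀ δ : M, ∃ F : K → M, Iio δ ⊆ range F :=
    fun δ => exists_range_superset (card_Iio_le_of_succ δ)
  choose F hF using hF
  have hE : ∀ ρ : K, ∃ E : Pt θ → K, Iio ρ ⊆ range E :=
    fun ρ => exists_range_superset (card_Iio_le_of_succ ρ)
  choose E hE using hE
  -- approximations of size at most `θ` of the initial segments
  let A : K → M → Set M := fun ε δ => {y | y < δ ∧ ∃ k < ε, F δ k = y}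
  have hcardA : ∀ ε δ, #(A ε δ) < Order.succ θ := by
    intro ε δ
    refine (mk_le_mk_of_subset (t := F δ '' Iio ε) ?_).trans_lt
      (mk_image_le.trans_lt (card_Iio_lt ε))
    rintro y ⟨-, k, hk, rfl⟩
    exact ⟨k, hk, rfl⟩
  have hr : ∀ ε, ∃ r : M → K, ∀ y, ∀ z ∈ A ε y, r z < r y := by
    intro ε
    obtain ⟨r, hr⟩ := exists_wf_rec (L := M) (X := K)
      (fun y f b => ∀ z (hz : z ∈ A ε y), f z hz.1 < b) (by
        intro y f
        obtain ⟨b, hb⟩ := exists_forall_lt_fun hregK (fun z : A ε y => f z.1 z.2.1) (hcardA ε y)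
        exact ⟨b, fun z hz => hb ⟨z, hz⟩⟩)
    exact ⟨r, fun y z hz => hr y z hz⟩
  choose r hr using hr
  refine ⟨fun _ => K × K, fun β p x =>
    if h : ∃ y ∈ A p.1 β, r p.1 y = E p.2 x then h.choose else β, fun _ => ?_, fun s => ?_⟩
  · rw [← mul_def, card_Pt, mul_eq_self hregK.1]
    exact Order.lt_succ _
  obtain ⟨q, hq⟩ := exists_climbing hregM (X := Pt θ)
    (by rw [card_Pt]; exact (Order.lt_succ θ).trans (Order.lt_succ _)) s
  obtain ⟨δ, hδ⟩ := exists_forall_lt_fun hregM q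
    (by rw [card_Pt]; exact (Order.lt_succ θ).trans (Order.lt_succ _))
  choose! idx hidx using (fun (y : M) (z : M) (hz : z < y) => hF y hz)
  -- a stage at which the approximations cohere
  obtain ⟨b, hb⟩ := exists_forall_lt_fun hregK (fun ζ => idx δ (q ζ))
    (by rw [card_Pt]; exact Order.lt_succ θ)
  -- The two bounds translate the enumeration of a member of `δ` into that of `δ`, and back; closure
  -- under both makes the approximations cohere.
  have hφ : ∀ k : K, ∃ c : K, ∀ k₁ ≤ k, ∀ k₂ ≤ k,
      idx δ (F (F δ k₁) k₂) < c ∧ idx (F δ k₁) (F δ k₂) < c := by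
    intro k
    have hk : #(Iic k × Iic k) < Order.succ θ := by
      rw [← mul_def]
      exact mul_lt_of_lt hregK.1 (card_Iic_lt hregK.1 k) (card_Iic_lt hregK.1 k)
    obtain ⟨c, hc⟩ := exists_forall_lt_fun hregK
      (fun p : Iic k × Iic k => idx δ (F (F δ p.1) p.2)) hk
    obtain ⟨d, hd⟩ := exists_forall_lt_fun hregK
      (fun p : Iic k × Iic k => idx (F δ p.1) (F δ p.2)) hk
    exact ⟨max c d, fun k₁ h₁ k₂ h₂ => ⟨(hc (⟨k₁, h₁⟩, ⟨k₂, h₂⟩)).trans_le (le_max_left _ _),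
      (hd (⟨k₁, h₁⟩, ⟨k₂, h₂⟩)).trans_le (le_max_right _ _)⟩⟩
  choose φ hφ using hφ
  obtain ⟨ε, hbε, hε⟩ := exists_closedPt_gt hregK huncK φ b
  have hqA : ∀ ζ, q ζ ∈ A ε δ :=
    fun ζ => ⟨hδ ζ, idx δ (q ζ), (hb ζ).trans hbε, hidx _ _ (hδ ζ)⟩
  have hcoh : ∀ y ∈ A ε δ, ∀ z, z ∈ A ε y ↔ z ∈ A ε δ ∧ z < y := by
    rintro y ⟨hy, k, hk, rfl⟩ z
    constructor
    · rintro ⟨hz, k', hk', rfl⟩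
      refine ⟨⟨hz.trans hy, idx δ (F (F δ k) k'), ?_, hidx _ _ (hz.trans hy)⟩, hz⟩
      exact ((hφ (max k k') k (le_max_left _ _) k' (le_max_right _ _)).1).trans
        (hε _ (max_lt hk hk'))
    · rintro ⟨⟨hz, k', hk', rfl⟩, hzy⟩
      refine ⟨hzy, idx (F δ k) (F δ k'), ?_, hidx _ _ hzy⟩
      exact ((hφ (max k k') k (le_max_left _ _) k' (le_max_right _ _)).2).trans
        (hε _ (max_lt hk hk'))
  have hinj : ∀ y ∈ A ε δ, ∀ z ∈ A ε δ, r ε y = r ε z → y = z := by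
    intro y hy z hz h
    rcases lt_trichotomy y z with h' | h' | h'
    · exact absurd h (hr ε z y ((hcoh z hz y).2 ⟨hy, h'⟩)).ne
    · exact h'
    · exact absurd h (hr ε y z ((hcoh y hy z).2 ⟨hz, h'⟩)).ne'
  obtain ⟨ρ, hρ⟩ := exists_forall_lt_fun hregK (fun ζ => r ε (q ζ))
    (by rw [card_Pt]; exact Order.lt_succ θ)
  choose e he using fun ζ => hE ρ (hρ ζ)
  refine ⟨q, e, fun ζ ξ h => ⟨(hq ζ ξ h).1, (hq ζ ξ h).2.le⟩, fun ξ => ⟨(ε, ρ), ?_⟩⟩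
  intro ζ hζ
  have hex : ∃ y ∈ A ε (q ξ), r ε y = E ρ (e ζ) :=
    ⟨q ζ, (hcoh _ (hqA ξ) _).2 ⟨hqA ζ, (hq ζ ξ hζ).1⟩, (he ζ).symm⟩
  simp only [hex, dite_true]
  exact hinj _ ((hcoh _ (hqA ξ) _).1 hex.choose_spec.1).1 _ (hqA ζ)
    (hex.choose_spec.2.trans (he ζ))

/-! ### Club guessing. -/

theorem ClosedPt.exists_greatest {κ : Cardinal.{u}} (φ : Pt κ → Pt κ) (γ : Pt κ) :
    ∃ i ≤ γ, ClosedPt φ i ∧ ∀ j ≤ γ, ClosedPt φ j → j ≤ i := by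
  obtain ⟨i, hi, hmin⟩ := wellFounded_lt.has_min {i | ∀ j ≤ γ, ClosedPt φ j → j ≤ i}
    ⟨γ, fun j hj _ => hj⟩
  refine ⟨i, not_lt.1 fun h => hmin γ (fun j hj _ => hj) h, fun j hj => ?_, hi⟩
  -- A point below the least upper bound lies below some closed point, and that closed point already
  -- bounds its `φ`-value.
  by_contra hcon
  refine hmin j (fun k hk hk' => ?_) hj
  by_contra! hjk
  exact hcon ((hk' j hjk).trans_le (hi k hk hk'))

/-- The greatest `φ`-closed point below `γ`. -/
noncomputable def drop {κ : Cardinal.{u}} (φ : Pt κ → Pt κ) (γ : Pt κ) : Pt κ :=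
  (ClosedPt.exists_greatest φ γ).choose

theorem drop_le {κ : Cardinal.{u}} (φ : Pt κ → Pt κ) (γ : Pt κ) : drop φ γ ≤ γ :=
  (ClosedPt.exists_greatest φ γ).choose_spec.1

theorem closedPt_drop {κ : Cardinal.{u}} (φ : Pt κ → Pt κ) (γ : Pt κ) :
    ClosedPt φ (drop φ γ) :=
  (ClosedPt.exists_greatest φ γ).choose_spec.2.1

theorem le_drop {κ : Cardinal.{u}} {φ : Pt κ → Pt κ} {γ j : Pt κ} (hj : j ≤ γ)
    (h : ClosedPt φ j) : j ≤ drop φ γ :=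
  (ClosedPt.exists_greatest φ γ).choose_spec.2.2 j hj h

theorem drop_eq_self {κ : Cardinal.{u}} {φ : Pt κ → Pt κ} {γ : Pt κ} (h : ClosedPt φ γ) :
    drop φ γ = γ :=
  (drop_le φ γ).antisymm (le_drop le_rfl h)

theorem ClosedPt.mono {κ : Cardinal.{u}} {φ ψ : Pt κ → Pt κ} (h : ∀ x, φ x ≤ ψ x) {i : Pt κ}
    (hi : ClosedPt ψ i) : ClosedPt φ i :=
  fun j hj => (h j).trans_lt (hi j hj)

theorem exists_stable_of_antitone {K L : Type*} [LinearOrder L] [WellFoundedLT L]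
    [LinearOrder K] [Nonempty K] {f : K → L} (hf : Antitone f) :
    ∃ k, ∀ l, k ≤ l → f l = f k := by
  obtain ⟨_, ⟨k, rfl⟩, hk⟩ := wellFounded_lt.has_min (range f) (range_nonempty f)
  exact ⟨k, fun l hl => (hf hl).antisymm (not_lt.1 (hk _ ⟨l, rfl⟩))⟩

/-- Club guessing by sequences of length `θ` in `θ⁺⁺`. -/
theorem exists_guessing {θ : Cardinal.{u}} (hθ : ℵ₀ ≤ θ) :
    ∃ (A : Type u) (c : A → Pt θ → Pt (Order.succ (Order.succ θ))),
      #A ≤ Order.succ (Order.succ θ) ∧ (∀ a, StrictMono (c a)) ∧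
      ∀ φ, ∃ a, ∀ x, ClosedPt φ (c a x) := by
  classical
  set K := Pt (Order.succ θ)
  set M := Pt (Order.succ (Order.succ θ))
  have hregK : (Order.succ θ).IsRegular := isRegular_succ hθ
  have hregM := isRegular_succ_succ hθ
  have huncM : ℵ₀ < Order.succ (Order.succ θ) :=
    (Order.lt_succ_iff.2 hθ).trans (Order.lt_succ _)
  have hcardΘ : #(Pt θ) < Order.succ (Order.succ θ) := by
    rw [card_Pt]; exact (Order.lt_succ θ).trans (Order.lt_succ _)
  have : Nonempty M := nonempty_Pt hregM.ne_zero
  have : Nonempty K := nonempty_Pt hregK.ne_zero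
  have : NoMaxOrder K := Cardinal.noMaxOrder hregK.1
  have hF : ∀ δ : M, ∃ F : K → M, Iio δ ⊆ range F :=
    fun δ => exists_range_superset (card_Iio_le_of_succ δ)
  choose F hF using hF
  obtain ⟨c₀, hc₀⟩ := exists_climbing hregM (X := Pt θ) hcardΘ id
  let X : M × K → Set M := fun p => F p.1 '' Iio p.2
  have hX : ∀ p, #(X p) < Order.succ θ := fun p => mk_image_le.trans_lt (card_Iio_lt p.2)
  -- Small sets are pushed down to `ψ`-closed points, and an increasing θ-sequence is picked among
  -- the results; `c₀` is only a filler.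
  let c : (M → M) → M × K → Pt θ → M := fun ψ p =>
    if h : ∃ c : Pt θ → M, StrictMono c ∧ ∀ x, c x ∈ drop ψ '' X p then h.choose else c₀
  have hmono : ∀ ψ p, StrictMono (c ψ p) := by
    intro ψ p
    by_cases h : ∃ c : Pt θ → M, StrictMono c ∧ ∀ x, c x ∈ drop ψ '' X p
    · simp only [c, h, dite_true]; exact h.choose_spec.1
    · simp only [c, h, dite_false]; exact fun x y hxy => (hc₀ x y hxy).1
  by_contra hcon
  push Not at hcon
  have hbad : ∀ ψ, ∃ φ, ∀ a, ∃ x, ¬ ClosedPt φ (c ψ a x) := by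
    intro ψ
    refine hcon (M × K) (c ψ) ?_ (hmono ψ)
    rw [← mul_def, card_Pt, card_Pt]
    exact (mul_le_mul_right (Order.le_succ _) _).trans_eq (mul_eq_self hregM.1)
  choose bad hbad using hbad
  -- If every such family fails, correct `ψ` by its counterexamples θ⁺ times.
  obtain ⟨ψ, hψ⟩ := exists_wf_rec (L := K) (X := M → M)
    (fun ζ f b => ∀ ξ (h : ξ < ζ) x, f ξ h x ≤ b x ∧ bad (f ξ h) x ≤ b x) (by
      intro ζ f
      have h1 : ∀ x, ∃ b, ∀ ξ : Iio ζ, f ξ.1 ξ.2 x < b := fun x =>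
        exists_forall_lt_fun hregM (fun ξ : Iio ζ => f ξ.1 ξ.2 x)
          ((card_Iio_lt ζ).trans (Order.lt_succ _))
      have h2 : ∀ x, ∃ b, ∀ ξ : Iio ζ, bad (f ξ.1 ξ.2) x < b := fun x =>
        exists_forall_lt_fun hregM (fun ξ : Iio ζ => bad (f ξ.1 ξ.2) x)
          ((card_Iio_lt ζ).trans (Order.lt_succ _))
      choose b hb using h1
      choose d hd using h2
      exact ⟨fun x => max (b x) (d x), fun ξ h x => ⟨(hb x ⟨ξ, h⟩).le.trans (le_max_left _ _),
        (hd x ⟨ξ, h⟩).le.trans (le_max_right _ _)⟩⟩)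
  have hsup : ∀ x, ∃ b, ∀ ζ : K, ψ ζ x < b := fun x =>
    exists_forall_lt_fun hregM (fun ζ : K => ψ ζ x) (by rw [card_Pt]; exact Order.lt_succ _)
  choose ψ' hψ' using hsup
  -- `θ` many closed points for the limit function, covered by a single `X p`
  choose nxt hnxt hnxt' using exists_closedPt_gt hregM huncM ψ'
  obtain ⟨γ', hγ'⟩ := exists_climbing hregM (X := Pt θ) hcardΘ nxt
  let γ : Pt θ → M := fun x => nxt (γ' x)
  have hγmono : StrictMono γ := fun x y hxy => (hγ' x y hxy).2.trans (hnxt _)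
  obtain ⟨δ, hδ⟩ := exists_forall_lt_fun hregM γ hcardΘ
  choose idx hidx using fun x => hF δ (hδ x)
  obtain ⟨k, hk⟩ := exists_forall_lt_fun hregK idx (by rw [card_Pt]; exact Order.lt_succ θ)
  have hγX : ∀ x, γ x ∈ X (δ, k) := fun x => ⟨idx x, hk x, hidx x⟩
  -- As `ζ` grows fewer points are closed, so drops decrease and each stabilises; `X (δ, k)` has at
  -- most θ members, so one ζ < θ⁺ serves them all. From then on a correction changes nothing on `X
  -- (δ, k)`, and the guess made at `ζ` is closed under its own counterexample.
  have hanti : ∀ y, Antitone fun ζ => drop (ψ ζ) y := by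
    intro y ζ ξ h
    rcases h.eq_or_lt with rfl | h
    · exact le_rfl
    · exact le_drop (drop_le _ _) ((closedPt_drop _ _).mono fun x => (hψ ξ ζ h x).1)
  choose st hst using fun y => exists_stable_of_antitone (hanti y)
  obtain ⟨ζ, hζ⟩ := exists_forall_lt_fun hregK (fun y : X (δ, k) => st y) (hX _)
  obtain ⟨ξ, hξ⟩ := exists_gt ζ
  have hstab : ∀ y ∈ X (δ, k), drop (ψ ξ) y = drop (ψ ζ) y := by
    intro y hy
    rw [hst y ξ ((hζ ⟨y, hy⟩).le.trans hξ.le), hst y ζ (hζ ⟨y, hy⟩).le]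
  have hex : ∃ c : Pt θ → M, StrictMono c ∧ ∀ x, c x ∈ drop (ψ ζ) '' X (δ, k) :=
    ⟨γ, hγmono, fun x => ⟨γ x, hγX x, drop_eq_self ((hnxt' _).mono fun x => (hψ' x ζ).le)⟩⟩
  obtain ⟨x, hx⟩ := hbad (ψ ζ) (δ, k)
  refine hx ?_
  have hc : c (ψ ζ) (δ, k) = hex.choose := by simp only [c, hex, dite_true]
  rw [hc]
  obtain ⟨y, hy, hy'⟩ := hex.choose_spec.2 x
  rw [← hy', ← hstab y hy]
  exact (closedPt_drop _ _).mono fun x => (hψ ξ ζ hξ x).2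

/-! ### Approachability above θ⁺⁺. -/

/-- The least strict upper bound of the values of `h` below `i`. -/
theorem exists_strictSup {lam μ : Cardinal.{u}} (hlam : lam.IsRegular) (hμ : μ < lam) :
    ∃ S : (Pt μ → Pt lam) → Pt μ → Pt lam, ∀ h i b, S h i ≤ b ↔ ∀ j < i, h j < b := by
  have : ∀ (h : Pt μ → Pt lam) i, ∃ s, ∀ b, s ≤ b ↔ ∀ j < i, h j < b := by
    intro h i
    obtain ⟨b, hb⟩ := exists_forall_lt_fun hlam h (by rwa [card_Pt])
    obtain ⟨s, hs, hmin⟩ := wellFounded_lt.has_min {b | ∀ j < i, h j < b} ⟨b, fun j _ => hb j⟩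
    exact ⟨s, fun b => ⟨fun hsb j hj => (hs j hj).trans_le hsb,
      fun hb => not_lt.1 fun h => hmin b hb h⟩⟩
  choose S hS using this
  exact ⟨S, hS⟩

/-- Build an increasing `ξ` of length θ⁺⁺ with supremum `δ` and compare it with the cofinal sequence
`d δ` fixed beforehand. On a club their strict suprema agree, and guessing finds a θ-sequence in
that club. Its initial segments are thus computable from `d δ`; as `ξ` outgrows an index of each
segment once the segment is determined, some earlier `δ'` yields it too, in time to be listed. -/
theorem approachable_of_lt {lam θ : Cardinal.{u}} (hθ : ℵ₀ ≤ θ) (hlam : lam.IsRegular)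
    (hlt : Order.succ (Order.succ θ) < lam) : Approachable lam θ := by
  classical
  set M := Pt (Order.succ (Order.succ θ))
  have hregM := isRegular_succ_succ hθ
  have huncM : ℵ₀ < Order.succ (Order.succ θ) :=
    (Order.lt_succ_iff.2 hθ).trans (Order.lt_succ _)
  have : Nonempty M := nonempty_Pt hregM.ne_zero
  have : NoMaxOrder M := Cardinal.noMaxOrder hregM.1
  have : NoMaxOrder (Pt θ) := Cardinal.noMaxOrder hθ
  have : Nonempty (Pt lam) := nonempty_Pt hlam.ne_zero
  let z : Pt lam := Classical.arbitrary _
  obtain ⟨A, c, hA, hcmono, hc⟩ := exists_guessing hθ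
  obtain ⟨S, hS⟩ := exists_strictSup hlam hlt
  have hScongr : ∀ h h' i, (∀ j < i, h j = h' j) → S h i = S h' i := by
    intro h h' i hh
    apply le_antisymm
    · rw [hS]; intro j hj; rw [hh j hj]; exact (hS h' i _).1 le_rfl j hj
    · rw [hS]; intro j hj; rw [← hh j hj]; exact (hS h i _).1 le_rfl j hj
  -- The cut at `k` makes `v ξ a k` depend only on `ξ` below `k`, so `ξ k` can be chosen above its
  -- index.
  let v : (M → Pt lam) → A → M → Pt θ → Pt lam := fun h a k x => if c a x < k then S h (c a x) else z
  have hd : ∀ δ : Pt lam, ∃ d : M → Pt lam,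
      (∃ h : M → Pt lam, (∀ k, h k < δ) ∧ ∀ b < δ, ∃ k, b ≤ h k) →
      (∀ k, d k < δ) ∧ ∀ b < δ, ∃ k, b ≤ d k := by
    intro δ
    by_cases h : ∃ h : M → Pt lam, (∀ k, h k < δ) ∧ ∀ b < δ, ∃ k, b ≤ h k
    · exact ⟨h.choose, fun _ => h.choose_spec⟩
    · exact ⟨fun _ => z, fun h' => absurd h' h⟩
  choose d hd using hd
  refine ⟨fun α => Iio α × (A × M), fun α τ => v (d τ.1.1) τ.2.1 τ.2.2, fun α => ?_, fun s => ?_⟩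
  · rw [← mul_def, ← mul_def]
    refine mul_lt_of_lt hlam.1 (card_Iio_lt α) ?_
    refine mul_lt_of_lt hlam.1 (hA.trans_lt hlt) ?_
    rwa [card_Pt]
  have hcatch : ∀ w : Pt θ → Pt lam, ∃ σ : Pt lam,
      (∃ δ a k, w = v (d δ) a k) → ∃ δ < σ, ∃ a k, w = v (d δ) a k := by
    intro w
    by_cases h : ∃ δ a k, w = v (d δ) a k
    · obtain ⟨δ, a, k, h⟩ := h
      obtain ⟨σ, hσ⟩ := exists_forall_lt hlam (s := {δ}) (by simpa using one_lt_aleph0.trans_le hlam.1)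
      exact ⟨σ, fun _ => ⟨δ, hσ δ rfl, a, k, h⟩⟩
    · exact ⟨z, fun h' => absurd h' h⟩
  choose idx hidx using hcatch
  obtain ⟨ξ, hξ⟩ := exists_wf_rec (L := M) (X := Pt lam)
    (fun j f b => (∀ k (hk : k < j), f k hk < b) ∧ ∀ g : M → Pt lam, (∀ k hk, g k = f k hk) →
      (∀ k ≤ j, S g k ≤ b ∧ s (S g k) ≤ b) ∧ ∀ a, ∀ k ≤ j, idx (v g a k) ≤ b) (by
      intro j f
      let g : M → Pt lam := fun k => if hk : k < j then f k hk else z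
      obtain ⟨b₁, hb₁⟩ := exists_forall_lt_fun hlam g (by rwa [card_Pt])
      obtain ⟨b₂, hb₂⟩ := exists_forall_lt_fun hlam (fun k : M => S g k) (by rwa [card_Pt])
      obtain ⟨b₃, hb₃⟩ := exists_forall_lt_fun hlam (fun k : M => s (S g k)) (by rwa [card_Pt])
      obtain ⟨b₄, hb₄⟩ := exists_forall_lt_fun hlam (fun p : A × M => idx (v g p.1 p.2)) (by
        rw [← mul_def]
        refine mul_lt_of_lt hlam.1 (hA.trans_lt hlt) ?_
        rwa [card_Pt])
      refine ⟨max (max b₁ b₂) (max b₃ b₄), fun k hk => ?_, fun g' hg' => ?_⟩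
      · have : f k hk = g k := by simp only [g, hk, dite_true]
        rw [this]
        exact (hb₁ k).trans_le ((le_max_left _ _).trans (le_max_left _ _))
      have hSg : ∀ k ≤ j, S g' k = S g k := by
        intro k hk
        refine hScongr _ _ _ fun i hi => ?_
        have hi' := hi.trans_le hk
        simp only [g, hi', dite_true, hg' i hi']
      refine ⟨fun k hk => ?_, fun a k hk => ?_⟩
      · rw [hSg k hk]
        exact ⟨(hb₂ k).le.trans ((le_max_right _ _).trans (le_max_left _ _)),
          (hb₃ k).le.trans ((le_max_left _ _).trans (le_max_right _ _))⟩
      · have : v g' a k = v g a k := by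
          funext x
          simp only [v]
          split_ifs with h
          · exact hSg _ (h.le.trans hk)
          · rfl
        rw [this]
        exact (hb₄ (a, k)).le.trans ((le_max_right _ _).trans (le_max_right _ _)))
  have hξ1 : ∀ k j, k < j → ξ k < ξ j := fun k j h => (hξ j).1 k h
  have hξ2 : ∀ k j, k ≤ j → S ξ k ≤ ξ j ∧ s (S ξ k) ≤ ξ j :=
    fun k j h => ((hξ j).2 ξ fun _ _ => rfl).1 k h
  have hξ3 : ∀ a k j, k ≤ j → idx (v ξ a k) ≤ ξ j :=
    fun a k j h => ((hξ j).2 ξ fun _ _ => rfl).2 a k h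
  obtain ⟨b, hb⟩ := exists_forall_lt_fun hlam ξ (by rwa [card_Pt])
  obtain ⟨δ, hδ, hmin⟩ := wellFounded_lt.has_min {b | ∀ j, ξ j < b} ⟨b, hb⟩
  obtain ⟨hd1, hd2⟩ := hd δ ⟨ξ, hδ, fun b hb => by
    by_contra! h
    exact hmin b h hb⟩
  have hd3 : ∀ b < δ, ∃ k, b ≤ ξ k := fun b hb => by
    by_contra! h
    exact hmin b h hb
  choose k₁ hk₁ using fun j => hd2 (ξ j) (hδ j)
  choose k₂ hk₂ using fun j => hd3 (d δ j) (hd1 j)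
  choose k₃ hk₃ using fun j : M => exists_gt j
  obtain ⟨a, ha⟩ := hc fun j => max (k₁ j) (max (k₂ j) (k₃ j))
  have ha1 : ∀ x, S ξ (c a x) = S (d δ) (c a x) := by
    intro x
    apply le_antisymm
    · rw [hS]
      intro j hj
      exact (hk₁ j).trans_lt ((hS (d δ) _ _).1 le_rfl _ ((le_max_left _ _).trans_lt (ha x j hj)))
    · rw [hS]
      intro j hj
      exact (hk₂ j).trans_lt ((hS ξ _ _).1 le_rfl _
        (((le_max_left _ _).trans (le_max_right _ _)).trans_lt (ha x j hj)))
  have ha2 : ∀ k, v ξ a k = v (d δ) a k := by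
    intro k
    funext x
    simp only [v, ha1 x]
  have hξS : ∀ j i, j < i → ξ j < S ξ i := fun j i h => (hS ξ i _).1 le_rfl j h
  have hsucc : ∀ x : Pt θ, x < Order.succ x := Order.lt_succ
  -- The shift by one leaves room for the cut `k` between `c a ζ'` and `c a (succ ζ')`.
  refine ⟨fun ζ => S ξ (c a (Order.succ ζ)), fun ζ => Order.succ ζ, fun ζ ζ' h => ?_, fun ζ' => ?_⟩
  · have h1 : c a (Order.succ ζ) ≤ c a ζ' := (hcmono a).monotone (Order.succ_le_of_lt h)
    have h2 := hξS (c a ζ') (c a (Order.succ ζ')) (hcmono a (hsucc ζ'))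
    exact ⟨(hξ2 _ _ h1).1.trans_lt h2, (hξ2 _ _ h1).2.trans h2.le⟩
  · set k := k₃ (c a ζ') with hk
    have hklt : k < c a (Order.succ ζ') :=
      ((le_max_right _ _).trans (le_max_right _ _)).trans_lt
        (ha (Order.succ ζ') (c a ζ') (hcmono a (hsucc ζ')))
    obtain ⟨δ', hδ', a', k', hv⟩ := hidx (v ξ a k) ⟨δ, a, k, ha2 k⟩
    refine ⟨(⟨δ', hδ'.trans ((hξ3 a k k le_rfl).trans_lt (hξS k _ hklt))⟩, a', k'), ?_⟩
    intro ζ hζ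
    show v (d δ') a' k' (Order.succ ζ) = S ξ (c a (Order.succ ζ))
    rw [← hv]
    have : c a (Order.succ ζ) < k :=
      ((hcmono a).monotone (Order.succ_le_of_lt hζ)).trans_lt (hk₃ (c a ζ'))
    simp only [v, this, if_true]

theorem approachable {lam θ : Cardinal.{u}} (hθ : ℵ₀ ≤ θ) (hlam : lam.IsRegular)
    (h : Order.succ (Order.succ θ) ≤ lam) : Approachable lam θ := by
  rcases h.eq_or_lt with rfl | h
  · exact approachable_succ_succ hθ
  · exact approachable_of_lt hθ hlam h

section

variable {ι : Type u} {lam : ι → Cardinal.{u}} {I K : Order.Ideal (Set ι)}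

/-! ### Ideals and ultrafilters -/

theorem mem_dual {A : Set ι} : A ∈ dual K ↔ Aᶜ ∈ K := Filter.mem_comk

theorem eventually_dual {p : ι → Prop} : (∀ᶠ i in dual K, p i) ↔ {i | ¬ p i} ∈ K := mem_dual

theorem DisjointTo.le_dual {D : Ultrafilter ι} (h : DisjointTo D K) : (D : Filter ι) ≤ dual K := by
  intro A hA
  have := h _ (mem_dual.1 hA)
  rwa [Ultrafilter.compl_mem_iff_notMem, not_not] at this

theorem dual_anti (h : I ≤ K) : dual K ≤ dual I :=
  fun _ hA => mem_dual.2 (h (mem_dual.1 hA))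

theorem exists_disjointTo {A : Set ι} (hA : A ∉ K) :
    ∃ D : Ultrafilter ι, DisjointTo D K ∧ A ∈ D := by
  have : (dual K ⊓ Filter.principal A).NeBot := by
    rw [Filter.inf_principal_neBot_iff]
    intro B hB
    by_contra h
    refine hA (K.lower ?_ (mem_dual.1 hB))
    intro i hi hiB
    exact h ⟨i, hiB, hi⟩
  refine ⟨Ultrafilter.of (dual K ⊓ Filter.principal A), fun B hB hBD => ?_, ?_⟩
  · have h1 : Bᶜ ∈ Ultrafilter.of (dual K ⊓ Filter.principal A) :=
      Ultrafilter.of_le _ (Filter.mem_inf_of_left (mem_dual.2 (by rwa [compl_compl])))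
    exact Ultrafilter.compl_mem_iff_notMem.1 h1 hBD
  · exact Ultrafilter.of_le _ (Filter.mem_inf_of_right (Filter.mem_principal_self A))

theorem notMem_of_mem {D : Ultrafilter ι} (h : DisjointTo D K) {A : Set ι} (hA : A ∈ D) :
    A ∉ K := fun h' => h A h' hA

theorem union_mem {A B : Set ι} (hA : A ∈ K) (hB : B ∈ K) : A ∪ B ∈ K :=
  Order.Ideal.sup_mem hA hB

/-! ### Products of regular cardinals -/

theorem exists_pointwise_gt (hreg : ∀ i, (lam i).IsRegular) (f : Product lam) :
    ∃ g : Product lam, ∀ i, f i < g i := by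
  have := fun i => exists_forall_lt (hreg i) (s := {f i})
    (by simpa using one_lt_aleph0.trans_le (hreg i).1)
  choose g hg using this
  exact ⟨g, fun i => hg i _ rfl⟩

theorem nonempty_product (hreg : ∀ i, (lam i).IsRegular) : Nonempty (Product lam) :=
  have := fun i => nonempty_Pt (hreg i).ne_zero
  inferInstance

theorem ModLE.trans {F : Filter ι} {f g h : Product lam} (h₁ : ModLE F f g) (h₂ : ModLE F g h) :
    ModLE F f h := by
  filter_upwards [h₁, h₂] with i a b using a.trans b

theorem ModLE.trans_lt {F : Filter ι} {f g h : Product lam} (h₁ : ModLE F f g)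
    (h₂ : ModLT F g h) : ModLT F f h := by
  filter_upwards [h₁, h₂] with i a b using a.trans_lt b

theorem ModLT.trans_le {F : Filter ι} {f g h : Product lam} (h₁ : ModLT F f g)
    (h₂ : ModLE F g h) : ModLT F f h := by
  filter_upwards [h₁, h₂] with i a b using a.trans_le b

theorem ModLT.le {F : Filter ι} {f g : Product lam} (h : ModLT F f g) : ModLE F f g :=
  h.mono fun _ => le_of_lt

theorem ModLT.irrefl {F : Filter ι} [F.NeBot] {f : Product lam} (h : ModLT F f f) : False := by
  obtain ⟨i, hi⟩ := h.exists
  exact lt_irrefl _ hi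

theorem modLE_refl {F : Filter ι} (f : Product lam) : ModLE F f f :=
  Filter.Eventually.of_forall fun _ => le_rfl

theorem modLT_of_not_modLE {D : Ultrafilter ι} {f g : Product lam}
    (h : ¬ ModLE (D : Filter ι) f g) : ModLT (D : Filter ι) g f := by
  have := Ultrafilter.eventually_not.2 h
  exact this.mono fun _ => not_le.1

theorem Directed.exists_gt {F : Filter ι} {μ : Cardinal.{u}} (hreg : ∀ i, (lam i).IsRegular)
    (h : Directed F lam μ) {X : Type u} (hX : #X < μ) (f : X → Product lam) :
    ∃ g, ∀ x, ModLT F (f x) g := by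
  obtain ⟨g, hg⟩ := h (range f) (mk_range_le.trans_lt hX)
  obtain ⟨g', hg'⟩ := exists_pointwise_gt hreg g
  exact ⟨g', fun x => (hg _ ⟨x, rfl⟩).trans_lt (Filter.Eventually.of_forall hg')⟩

theorem directed_of_lt (hreg : ∀ i, (lam i).IsRegular) {θ : Cardinal.{u}} (h : ∀ i, θ < lam i)
    (F : Filter ι) : Directed F lam (Order.succ θ) := by
  intro A hA
  have := fun i => exists_forall_lt_fun (hreg i) (fun f : A => f.1 i)
    ((Order.lt_succ_iff.1 hA).trans_lt (h i))
  choose g hg using this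
  exact ⟨g, fun f hf => Filter.Eventually.of_forall fun i => (hg i ⟨f, hf⟩).le⟩

/-! ### True cofinality -/

/-- A shorter cofinal sequence would be dominated termwise by fewer than μ terms of `p`, hence by a
single one. -/
theorem hasTcf_of_scale {F : Filter ι} [F.NeBot] {μ : Cardinal.{u}} (hμ : μ.IsRegular)
    (p : Pt μ → Product lam) (hp : ∀ α β, α < β → ModLT F (p α) (p β))
    (hc : ∀ q, ∃ α, ModLE F q (p α)) : HasTcf F lam μ := by
  refine ⟨⟨p, hp, hc⟩, ?_⟩
  rintro ν ⟨r, -, hr⟩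
  by_contra! hlt
  choose b hb using fun β => hc (r β)
  obtain ⟨α, hα⟩ := exists_forall_lt_fun hμ b (by rwa [card_Pt])
  obtain ⟨β, hβ⟩ := hr (p α)
  exact ((hβ.trans (hb β)).trans_lt (hp _ _ (hα β))).irrefl

/-- Take a cofinal set of least size. The order being linear, a smaller set is strictly bounded, so
the cofinal set can be climbed recursively. -/
theorem exists_minimal_scale (D : Ultrafilter ι) (lam : ι → Cardinal.{u}) :
    ∃ μ ∈ scaleLengths (D : Filter ι) lam, ∀ A : Set (Product lam), #A < μ →
      ∃ h, ∀ f ∈ A, ModLT (D : Filter ι) f h := by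
  let S : Set Cardinal.{u} :=
    {κ | ∃ C : Set (Product lam), #C = κ ∧ ∀ q, ∃ f ∈ C, ModLE (D : Filter ι) q f}
  have hS : S.Nonempty := ⟨_, univ, rfl, fun q => ⟨q, mem_univ _, modLE_refl q⟩⟩
  have hmin : ∀ C : Set (Product lam), #C < sInf S → ∃ h, ∀ f ∈ C, ModLT (D : Filter ι) f h := by
    intro C hC
    by_contra! hcon
    refine (csInf_le' (s := S) ⟨C, rfl, fun q => ?_⟩).not_gt hC
    obtain ⟨f, hf, hfq⟩ := hcon q
    exact ⟨f, hf, by_contra fun h => hfq (modLT_of_not_modLE h)⟩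
  refine ⟨sInf S, ?_, hmin⟩
  obtain ⟨C, hC, hcof⟩ := csInf_mem hS
  rw [← card_Pt (sInf S)] at hC
  obtain ⟨e⟩ := Cardinal.eq.1 hC
  obtain ⟨p, hp⟩ := exists_wf_rec (L := Pt (sInf S)) (X := Product lam)
    (fun α f b => (∀ β h, ModLT (D : Filter ι) (f β h) b) ∧
      ModLE (D : Filter ι) (e.symm α).1 b) (by
      intro α f
      obtain ⟨h, hh⟩ := hmin (range fun β : Iio α => f β.1 β.2)
        (mk_range_le.trans_lt (card_Iio_lt α))
      refine ⟨fun i => max (h i) ((e.symm α).1 i), fun β hβ => ?_,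
        Filter.Eventually.of_forall fun i => le_max_right _ _⟩
      exact (hh _ ⟨⟨β, hβ⟩, rfl⟩).trans_le (Filter.Eventually.of_forall fun i => le_max_left _ _))
  refine ⟨p, fun α β h => (hp β).1 α h, fun q => ?_⟩
  obtain ⟨f, hf, hq⟩ := hcof q
  refine ⟨e ⟨f, hf⟩, hq.trans ?_⟩
  have := (hp (e ⟨f, hf⟩)).2
  rwa [e.symm_apply_apply] at this

theorem exists_modLT_of_card_lt_tcf (D : Ultrafilter ι)
    {A : Set (Product lam)} (hA : #A < tcf (D : Filter ι) lam) :
    ∃ h, ∀ f ∈ A, ModLT (D : Filter ι) f h := by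
  obtain ⟨μ, hμ, h⟩ := exists_minimal_scale D lam
  exact h A (hA.trans_le (csInf_le' hμ))

theorem exists_modLT_fun (D : Ultrafilter ι) {X : Type u} (f : X → Product lam)
    (hX : #X < tcf (D : Filter ι) lam) : ∃ h, ∀ x, ModLT (D : Filter ι) (f x) h := by
  obtain ⟨h, hh⟩ := exists_modLT_of_card_lt_tcf D (A := range f) (mk_range_le.trans_lt hX)
  exact ⟨h, fun x => hh _ ⟨x, rfl⟩⟩

theorem tcf_mem_scaleLengths (D : Ultrafilter ι) (lam : ι → Cardinal.{u}) :
    tcf (D : Filter ι) lam ∈ scaleLengths (D : Filter ι) lam := by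
  obtain ⟨μ, hμ, -⟩ := exists_minimal_scale D lam
  exact csInf_mem ⟨μ, hμ⟩

theorem isRegular_tcf (hreg : ∀ i, (lam i).IsRegular) (D : Ultrafilter ι) :
    (tcf (D : Filter ι) lam).IsRegular := by
  obtain ⟨p, hp, hc⟩ := tcf_mem_scaleLengths D lam
  have hmono : ∀ α β, α ≤ β → ModLE (D : Filter ι) (p α) (p β) := by
    intro α β h
    rcases h.eq_or_lt with rfl | h
    · exact modLE_refl _
    · exact (hp _ _ h).le
  have hne : Nonempty (Pt (tcf (D : Filter ι) lam)) := by
    obtain ⟨q⟩ := nonempty_product hreg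
    exact ⟨(hc q).choose⟩
  have hmax : NoMaxOrder (Pt (tcf (D : Filter ι) lam)) := by
    refine ⟨fun α => ?_⟩
    obtain ⟨q, hq⟩ := exists_pointwise_gt hreg (p α)
    obtain ⟨β, hβ⟩ := hc q
    refine ⟨β, not_le.1 fun h => ?_⟩
    exact (ModLT.trans_le (F := D) (Filter.Eventually.of_forall hq) (hβ.trans (hmono _ _ h))).irrefl
  refine ⟨?_, ?_⟩
  · exact (Order.aleph0_le_cof (α := Pt (tcf (D : Filter ι) lam))).trans
      ((Order.cof_le_cardinalMk _).trans_eq (card_Pt _))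
  · by_contra! hlt
    rw [← Ordinal.cof_toType] at hlt
    obtain ⟨s, hs, hs'⟩ := Order.exists_cof_eq (Pt (tcf (D : Filter ι) lam))
    rw [← hs'] at hlt
    obtain ⟨h, hh⟩ := exists_modLT_fun D (fun α : s => p α) hlt
    obtain ⟨β, hβ⟩ := hc h
    obtain ⟨α, hα, hβα⟩ := hs β
    exact ((hβ.trans (hmono _ _ hβα)).trans_lt (hh ⟨α, hα⟩)).irrefl

theorem tcf_eq_of_scale {D : Ultrafilter ι} {μ : Cardinal.{u}} (hμ : μ.IsRegular)
    (p : Pt μ → Product lam) (hp : ∀ α β, α < β → ModLT (D : Filter ι) (p α) (p β))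
    (hc : ∀ q, ∃ α, ModLE (D : Filter ι) q (p α)) : tcf (D : Filter ι) lam = μ :=
  (hasTcf_of_scale hμ p hp hc).csInf_eq

theorem le_tcf_of_directed (hreg : ∀ i, (lam i).IsRegular) {μ : Cardinal.{u}}
    (h : Directed (dual K) lam μ) {D : Ultrafilter ι} (hD : DisjointTo D K) :
    μ ≤ tcf (D : Filter ι) lam := by
  by_contra! hlt
  obtain ⟨p, -, hc⟩ := tcf_mem_scaleLengths D lam
  obtain ⟨g, hg⟩ := h.exists_gt hreg (by rwa [card_Pt]) p
  obtain ⟨α, hα⟩ := hc g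
  exact (hα.trans_lt (hD.le_dual (hg α))).irrefl

/-! ### The ideals `J_{<μ}` -/

theorem mem_J {μ : Cardinal.{u}} {B : Set ι} : B ∈ J I lam μ ↔
    ∀ D : Ultrafilter ι, DisjointTo D I → B ∈ D → tcf (D : Filter ι) lam < μ := by
  change (¬ ∃ D : Ultrafilter ι, DisjointTo D I ∧ B ∈ D ∧ μ ≤ tcf (D : Filter ι) lam) ↔ _
  push Not
  rfl

theorem le_J {μ : Cardinal.{u}} : I ≤ J I lam μ :=
  fun _ hA => mem_J.2 fun _ hD hAD => absurd hAD (hD _ hA)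

theorem J_mono {μ ν : Cardinal.{u}} (h : μ ≤ ν) : J I lam μ ≤ J I lam ν :=
  fun _ hA => mem_J.2 fun D hD hAD => (mem_J.1 hA D hD hAD).trans_le h

theorem mem_Jle {μ : Cardinal.{u}} {B : Set ι} : B ∈ Jle I lam μ ↔
    ∀ D : Ultrafilter ι, DisjointTo D I → B ∈ D → tcf (D : Filter ι) lam ≤ μ := by
  simp only [Jle, mem_J, Order.lt_succ_iff]

theorem DisjointTo.of_le {D : Ultrafilter ι} (hD : DisjointTo D K) (h : I ≤ K) :
    DisjointTo D I := fun _ hA => hD _ (h hA)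

theorem DisjointTo.J {D : Ultrafilter ι} (hD : DisjointTo D I) {μ : Cardinal.{u}}
    (h : μ ≤ tcf (D : Filter ι) lam) : DisjointTo D (J I lam μ) :=
  fun _ hA hAD => (mem_J.1 hA D hD hAD).not_ge h

theorem comap_dual_neBot {B : Set ι} (hB : B ∉ K) :
    ((dual K).comap (Subtype.val : B → ι)).NeBot := by
  rw [Filter.comap_neBot_iff]
  intro A hA
  by_contra! h
  refine hB (K.lower ?_ (mem_dual.1 hA))
  intro i hi hiA
  exact h ⟨i, hi⟩ hiA

theorem eventually_comap_dual {B : Set ι} {p : ι → Prop} :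
    (∀ᶠ i : B in (dual K).comap (Subtype.val : B → ι), p i) ↔ {i | ¬ p i} ∩ B ∈ K := by
  rw [Filter.eventually_comap, eventually_dual]
  apply iff_of_eq
  congr 1
  ext i
  constructor
  · intro h
    rw [mem_ofPred_eq] at h
    push Not at h
    obtain ⟨b, rfl, hb⟩ := h
    exact ⟨hb, b.2⟩
  · rintro ⟨h, hi⟩
    rw [mem_ofPred_eq]
    push Not
    exact ⟨⟨i, hi⟩, rfl, h⟩

/-! ### Implications between the variants -/

/-- Constant sequences of generators work; members of pcf are nonzero, so no generator is lost. -/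
theorem PcfTheorem.weakPcfTheorem {θ : Cardinal.{u}} (hreg : ∀ i, (lam i).IsRegular)
    (h : PcfTheorem I lam θ) : WeakPcfTheorem I lam θ := by
  obtain ⟨h1, h2, B, h3, h4⟩ := h
  refine ⟨h1, h2, fun μ _ => B μ, fun μ _ α β _ => ?_, fun μ => ?_, fun μ hμ α => (h4 μ hμ).2.1⟩
  · simpa using (J I lam μ).lower (empty_subset _) (J I lam μ).nonempty.choose_spec
  · rw [h3 μ]
    congr 1
    ext A
    constructor
    · rintro ⟨ν, hν, hlt, rfl⟩
      obtain ⟨D, -, rfl⟩ := id hν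
      obtain ⟨α⟩ := nonempty_Pt (isRegular_tcf hreg D).ne_zero
      exact ⟨_, hν, hlt, α, rfl⟩
    · rintro ⟨ν, hν, hlt, -, rfl⟩
      exact ⟨ν, hν, hlt, rfl⟩

theorem mem_of_mem_plus {𝓑 : Set (Set ι)} {A : Set ι} (hA : A ∈ plus K 𝓑) {D : Ultrafilter ι}
    (hD : DisjointTo D K) (hAD : A ∈ D) : ∃ B ∈ 𝓑, B ∈ D := by
  obtain ⟨s, hs, hs𝓑, hA⟩ := hA
  have : ⋃₀ s ∈ D := by
    rcases Ultrafilter.union_mem_iff.1 (Filter.mem_of_superset hAD (subset_sdiff_union _ _)) with h | h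
    · exact absurd h (hD _ hA)
    · exact h
  rw [Ultrafilter.finite_sUnion_mem_iff hs] at this
  obtain ⟨B, hB, hBD⟩ := this
  exact ⟨B, hs𝓑 hB, hBD⟩

theorem le_plus {𝓑 : Set (Set ι)} : K ≤ plus K 𝓑 :=
  fun _ hA => ⟨∅, finite_empty, empty_subset _, K.lower sdiff_subset hA⟩

theorem subset_plus {𝓑 : Set (Set ι)} {B : Set ι} (hB : B ∈ 𝓑) : B ∈ plus K 𝓑 := by
  refine ⟨{B}, finite_singleton B, singleton_subset_iff.2 hB, ?_⟩
  simpa using K.lower (empty_subset _) K.nonempty.choose_spec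

theorem plus_le {K' : Order.Ideal (Set ι)} {𝓑 : Set (Set ι)} (hK : K ≤ K')
    (h : ∀ B ∈ 𝓑, B ∈ K') : plus K 𝓑 ≤ K' := by
  rintro A ⟨s, hs, hs𝓑, hA⟩
  have hU : ⋃₀ s ∈ K' := by
    clear hA
    induction s, hs using Set.Finite.induction_on with
    | empty => simpa using K'.lower (empty_subset _) K'.nonempty.choose_spec
    | insert _ _ ih =>
      rw [sUnion_insert]
      exact union_mem (h _ (hs𝓑 (mem_insert _ _))) (ih ((subset_insert _ _).trans hs𝓑))
  exact K'.lower (subset_sdiff_union _ _) (union_mem (hK hA) hU)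

/-- Otherwise directedness modulo J_{≤tcf} would push the true cofinality up to its own successor.
-/
theorem exists_mem_Jle (hreg : ∀ i, (lam i).IsRegular)
    (hdir : ∀ μ, Directed (dual (J I lam μ)) lam μ) {D : Ultrafilter ι} :
    ∃ A ∈ Jle I lam (tcf (D : Filter ι) lam), A ∈ D := by
  by_contra! h
  exact (le_tcf_of_directed hreg (hdir _) h).not_gt (Order.lt_succ _)

theorem WeakPcfTheorem.weakerPcfTheorem {θ : Cardinal.{u}} (hreg : ∀ i, (lam i).IsRegular)
    (h : WeakPcfTheorem I lam θ) : WeakerPcfTheorem I lam θ := by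
  obtain ⟨h1, h2, B, -, h4, h5⟩ := h
  refine ⟨h1, h2, ?_⟩
  rintro D hD _ rfl
  have hDI : DisjointTo D I := hD.of_le le_J
  obtain ⟨A, hA, hAD⟩ := exists_mem_Jle (I := I) hreg h2 (D := D)
  refine ⟨?_, ?_⟩
  · by_contra! hlt
    exact hD A (J_mono (Order.succ_le_of_lt hlt) hA) hAD
  have hA' := hA
  rw [Jle, h4] at hA'
  obtain ⟨_, ⟨ν, hν, hlt, α, rfl⟩, hBD⟩ := mem_of_mem_plus hA' hDI hAD
  have hmem : B ν α ∈ Jle I lam ν := by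
    rw [Jle, h4]
    exact subset_plus ⟨ν, hν, Order.lt_succ ν, α, rfl⟩
  -- The generator covers a set of J_{≤tcf}, so ν ≤ tcf; it lies in `D` and in J_{≤ν}, so tcf ≤ ν.
  obtain rfl : ν = tcf (D : Filter ι) lam :=
    (Order.lt_succ_iff.1 hlt).antisymm (mem_Jle.1 hmem D hDI hBD)
  exact ⟨B _ α, hBD, hmem, notMem_of_mem (hDI.J le_rfl) hBD, h5 _ hν α⟩

theorem WeakerPcfTheorem.weakestPcfTheorem {θ : Cardinal.{u}} (h : WeakerPcfTheorem I lam θ) :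
    WeakestPcfTheorem I lam θ :=
  ⟨h.1, fun μ _ => h.2.1 μ⟩

end

section

variable {ι : Type u} {lam : ι → Cardinal.{u}} {I : Order.Ideal (Set ι)} {θ : Cardinal.{u}}

/-! ### Consequences of the basic assumption -/

/-- The form in which the basic assumption is used: `live` says that `θ` steps can be bounded
uniformly, the step `ζ` being ignored on a set in the ideal. -/
structure Basic (I : Order.Ideal (Set ι)) (lam : ι → Cardinal.{u}) (θ : Cardinal.{u}) : Prop where
  regular : ∀ i, (lam i).IsRegular
  directed : Directed (dual I) lam (Order.succ θ)
  saturated : ∀ W : Pt θ → Set ι, (∀ ζ ξ, ζ < ξ → ∀ i, i ∈ W ζ → i ∉ W ξ) → ∃ ζ, W ζ ∈ I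
  live : ∃ T : ι → Set (Pt θ), (∀ i, #(T i) < lam i) ∧ ∀ ζ, {i | ζ ∉ T i} ∈ I

theorem weaklySaturated_wsat (I : Order.Ideal (Set ι)) :
    wsat I ≠ 0 ∧ WeaklySaturated I (wsat I) := by
  refine csInf_mem (s := {θ | θ ≠ 0 ∧ WeaklySaturated I θ}) ⟨Order.succ #ι, ?_, ?_⟩
  · exact (Order.succ_ne_bot _)
  · rintro ⟨T, A, hT, hdisj, -, hpos⟩
    have hne : ∀ t, (A t).Nonempty := by
      intro t
      rw [nonempty_iff_ne_empty]
      intro h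
      apply hpos t
      rw [h]
      exact I.lower (empty_subset _) I.nonempty.choose_spec
    choose a ha using hne
    have hinj : Function.Injective a := by
      intro s t hst
      by_contra hne
      exact Set.disjoint_left.1 (hdisj s t hne) (ha s) (hst ▸ ha t)
    exact (mk_le_of_injective hinj).not_gt (hT ▸ Order.lt_succ _)

theorem exists_mem_of_wsat_le (h : wsat I ≤ θ) (W : Pt θ → Set ι)
    (hW : ∀ ζ ξ, ζ < ξ → ∀ i, i ∈ W ζ → i ∉ W ξ) : ∃ ζ, W ζ ∈ I := by
  classical
  obtain ⟨h0, hsat⟩ := weaklySaturated_wsat I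
  by_contra! hcon
  obtain ⟨f⟩ : Nonempty (Pt (wsat I) ↪ Pt θ) := by
    rw [← Cardinal.le_def, card_Pt, card_Pt]; exact h
  obtain ⟨t₀⟩ := nonempty_Pt h0
  have hdisj : ∀ s t, s ≠ t → ∀ i, i ∈ W (f s) → i ∉ W (f t) := by
    intro s t hst i hs ht
    rcases lt_trichotomy (f s) (f t) with h' | h' | h'
    · exact hW _ _ h' i hs ht
    · exact hst (f.injective h')
    · exact hW _ _ h' i ht hs
  -- Keep wsat many of the sets and let the piece at `t₀` absorb everything uncovered, which makes
  -- the disjoint family a partition.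
  refine hsat ⟨Pt (wsat I), fun t => if t = t₀ then {i | ∀ s ≠ t₀, i ∉ W (f s)} else W (f t),
    card_Pt _, fun s t hst => ?_, ?_, fun t => ?_⟩
  · rw [Set.disjoint_left]
    intro i hs ht
    by_cases h1 : s = t₀ <;> by_cases h2 : t = t₀
    · exact hst (h1.trans h2.symm)
    · simp only [h1, h2, if_true, if_false] at hs ht
      exact hs t h2 ht
    · simp only [h1, h2, if_true, if_false] at hs ht
      exact ht s h1 hs
    · simp only [h1, h2, if_false] at hs ht
      exact hdisj s t hst i hs ht
  · refine eq_univ_of_forall fun i => mem_iUnion.2 ?_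
    by_cases h' : ∀ s ≠ t₀, i ∉ W (f s)
    · exact ⟨t₀, by simpa using h'⟩
    · push Not at h'
      obtain ⟨s, hs, hi⟩ := h'
      exact ⟨s, by simpa [hs] using hi⟩
  · by_cases h1 : t = t₀
    · simp only [h1, if_true]
      intro hmem
      refine hcon (f t₀) (I.lower ?_ hmem)
      intro i hi s hs
      exact hdisj t₀ s hs.symm i hi
    · simp only [h1, if_false]
      exact hcon _

theorem BasicAssumption.basic (h : BasicAssumption I lam θ) : Basic I lam θ := by
  classical
  obtain ⟨hreg, h⟩ := h
  have hsat : wsat I ≤ θ := by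
    rcases h with h | h
    · exact h.2
    · exact h.2.1
  have hdir : Directed (dual I) lam (Order.succ θ) := by
    rcases h with h | h
    · exact directed_of_lt hreg h.1 _
    · exact h.2.2
  have hlow : ∀ κ < θ, {i | lam i ≤ κ} ∈ I := by
    intro κ hκ
    rcases h with h | h
    · exact I.lower (fun i hi => absurd hi (hκ.trans (h.1 i)).not_ge) I.nonempty.choose_spec
    · by_contra hcon
      exact (csInf_le' (s := {μ | {i | lam i ≤ μ} ∉ I}) hcon).not_gt (hκ.trans_le h.1)
  refine ⟨hreg, hdir, fun W hW => exists_mem_of_wsat_le hsat W hW, ?_⟩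
  -- constant functions, and a bound for them
  obtain ⟨q⟩ := nonempty_product hreg
  let rk : Pt θ → Ordinal.{u} := fun ζ => Ordinal.typein (α := Pt θ) (· < ·) ζ
  let c : Pt θ → Product lam := fun ζ i =>
    if h : rk ζ < Ordinal.type (fun x y : Pt (lam i) => x < y) then
      Ordinal.enum (· < ·) ⟨rk ζ, h⟩ else q i
  obtain ⟨g, hg⟩ := hdir.exists_gt hreg (by rw [card_Pt]; exact Order.lt_succ _) c
  -- Where λ_i ≤ θ, the live `ζ` are those whose constant value is below `g i`. They inject into an
  -- initial segment of λ_i, so there are fewer than λ_i of them.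
  refine ⟨fun i => {ζ | θ < lam i ∨
    rk ζ < Ordinal.type (fun x y : Pt (lam i) => x < y) ∧ c ζ i < g i}, fun i => ?_, fun ζ => ?_⟩
  · by_cases hi : θ < lam i
    · exact (mk_set_le _).trans_lt ((card_Pt θ).trans_lt hi)
    · simp only [hi, false_or]
      refine (mk_le_of_injective (β := Iio (g i)) (f := fun ζ => ⟨c ζ.1 i, ζ.2.2⟩) ?_).trans_lt
        (card_Iio_lt _)
      rintro ⟨ζ, hζ, hζ'⟩ ⟨ξ, hξ, hξ'⟩ h
      have h' : c ζ i = c ξ i := congrArg (fun z => z.1) h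
      simp only [c, hζ, hξ, dite_true] at h'
      have h'' := congrArg (Ordinal.typein (α := Pt (lam i)) (· < ·)) h'
      rw [Ordinal.typein_enum, Ordinal.typein_enum] at h''
      exact Subtype.ext (Ordinal.typein_injective _ h'')
  · have hcard : (rk ζ).card < θ := by
      rw [← lt_ord, ← Ordinal.type_toType θ.ord]
      exact Ordinal.typein_lt_type _ _
    refine I.lower ?_ (union_mem (hlow _ hcard) (eventually_dual.1 (hg ζ)))
    intro i hi
    rw [mem_ofPred_eq, mem_ofPred_eq] at hi
    push Not at hi
    by_cases hr : rk ζ < Ordinal.type (fun x y : Pt (lam i) => x < y)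
    · exact Or.inr (not_lt.2 (hi.2 hr))
    · refine Or.inl ?_
      rw [Ordinal.type_toType, lt_ord, not_lt] at hr
      exact hr

/-- At each index only the fewer than λ_i live steps have to be bounded, so a pointwise bound exists
although λ_i may be at most θ. -/
theorem exists_steps {T : ι → Set (Pt θ)} (hreg : ∀ i, (lam i).IsRegular)
    (hT : ∀ i, #(T i) < lam i) {X : Type*}
    (step : (X → Product lam) → X → Product lam) :
    ∃ g : Pt θ → X → Product lam,
      ∀ ζ ξ, ζ < ξ → ∀ x i, ζ ∈ T i → step (g ζ) x i ≤ g ξ x i := by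
  obtain ⟨g, hg⟩ := exists_wf_rec (L := Pt θ) (X := X → Product lam)
    (fun ξ f b => ∀ ζ (h : ζ < ξ) x i, ζ ∈ T i → step (f ζ h) x i ≤ b x i) (by
      intro ξ f
      have : ∀ x i, ∃ b : Pt (lam i), ∀ ζ : {ζ : T i // ζ.1 < ξ}, step (f ζ.1.1 ζ.2) x i < b :=
        fun x i => exists_forall_lt_fun (hreg i) _ ((mk_subtype_le _).trans_lt (hT i))
      choose b hb using this
      exact ⟨b, fun ζ h x i hi => (hb x i ⟨⟨ζ, hi⟩, h⟩).le⟩)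
  exact ⟨g, fun ζ ξ h => hg ξ ζ h⟩

theorem exists_monotone_above {K : Order.Ideal (Set ι)} {κ : Cardinal.{u}}
    (hK : ∀ ν < κ, ∀ X : Type u, #X = ν → ∀ f : X → Product lam,
      ∃ g, ∀ x, ModLE (dual K) (f x) g) (f : Pt κ → Product lam) :
    ∃ F : Pt κ → Product lam, (∀ α β, α ≤ β → ModLE (dual K) (F α) (F β)) ∧
      ∀ α, ModLE (dual K) (f α) (F α) := by
  obtain ⟨F, hF⟩ := exists_wf_rec (L := Pt κ) (X := Product lam)
    (fun α F b => (∀ β h, ModLE (dual K) (F β h) b) ∧ ModLE (dual K) (f α) b) (by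
      intro α F
      obtain ⟨h, hh⟩ := hK _ (card_Iio_lt α) (Iio α) rfl fun β => F β.1 β.2
      refine ⟨fun i => max (h i) (f α i), fun β hβ => ?_,
        Filter.Eventually.of_forall fun i => le_max_right _ _⟩
      exact (hh ⟨β, hβ⟩).trans (Filter.Eventually.of_forall fun i => le_max_left _ _))
  refine ⟨F, fun α β h => ?_, fun α => (hF α).2⟩
  rcases h.eq_or_lt with rfl | h
  · exact modLE_refl _
  · exact (hF β).1 α h

theorem Basic.directed_J (h : Basic I lam θ) (μ : Cardinal.{u}) :
    Directed (dual (J I lam μ)) lam μ := by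
  suffices H : ∀ κ < μ, ∀ X : Type u, #X = κ → ∀ f : X → Product lam,
      ∃ g, ∀ x, ModLE (dual (J I lam μ)) (f x) g by
    intro A hA
    obtain ⟨g, hg⟩ := H _ hA A rfl (fun f => f.1)
    exact ⟨g, fun f hf => hg ⟨f, hf⟩⟩
  intro κ
  induction κ using WellFoundedLT.induction with
  | _ κ ih =>
  intro hκμ X hX f
  have hle : dual (J I lam μ) ≤ dual I := dual_anti le_J
  by_cases hκθ : κ ≤ θ
  · obtain ⟨g, hg⟩ := h.directed (range f) (mk_range_le.trans_lt (hX ▸ Order.lt_succ_iff.2 hκθ))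
    exact ⟨g, fun x => hle (hg _ ⟨x, rfl⟩)⟩
  rw [not_le] at hκθ
  by_cases hfin : κ < ℵ₀
  · have := fun i => exists_forall_lt_fun (h.regular i) (fun x => f x i)
      (hX ▸ hfin.trans_le (h.regular i).1)
    choose g hg using this
    exact ⟨g, fun x => Filter.Eventually.of_forall fun i => (hg i x).le⟩
  rw [not_lt] at hfin
  obtain ⟨e⟩ : Nonempty (X ≃ Pt κ) := Cardinal.eq.1 (hX.trans (card_Pt κ).symm)
  obtain ⟨F, hF, hfF⟩ := exists_monotone_above (fun ν hν => ih ν hν (hν.trans hκμ))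
    (fun α => f (e.symm α))
  suffices hb : ∃ g, ∀ α, ModLE (dual (J I lam μ)) (F α) g by
    obtain ⟨g, hg⟩ := hb
    refine ⟨g, fun x => ?_⟩
    have := hfF (e x)
    rw [e.symm_apply_apply] at this
    exact this.trans (hg _)
  by_cases hregκ : κ.IsRegular
  swap
  · obtain ⟨s, hs, hs'⟩ := Order.exists_cof_eq (Pt κ)
    have hlt : #s < κ := by
      rw [hs', Ordinal.cof_toType]
      by_contra! hcon
      exact hregκ ⟨hfin, hcon⟩
    obtain ⟨g, hg⟩ := ih _ hlt (hlt.trans hκμ) s rfl (fun α => F α)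
    refine ⟨g, fun α => ?_⟩
    obtain ⟨β, hβ, hαβ⟩ := hs α
    exact (hF _ _ hαβ).trans (hg ⟨β, hβ⟩)
  by_contra! hcon
  -- A failed bound `g` yields an ultrafilter of true cofinality at least μ where `F` passes `g`; as
  -- κ < μ, `F` is nevertheless bounded there.
  have hstep : ∀ g : Product lam, ∃ (D : Ultrafilter ι) (α : Pt κ) (b : Product lam),
      DisjointTo D I ∧ DisjointTo D (J I lam μ) ∧ ModLT (D : Filter ι) g (F α) ∧
      ∀ β, ModLT (D : Filter ι) (F β) b := by
    intro g
    obtain ⟨α, hα⟩ := hcon g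
    rw [ModLE, eventually_dual, mem_J] at hα
    push Not at hα
    obtain ⟨D, hD, hαD, hμ⟩ := hα
    obtain ⟨b, hb⟩ := exists_modLT_fun D F (by rw [card_Pt]; exact hκμ.trans_le hμ)
    exact ⟨D, α, b, hD, hD.J hμ, hαD, hb⟩
  choose D a b hDI hDJ hga hFb using hstep
  obtain ⟨T, hT, hTI⟩ := h.live
  obtain ⟨g, hg⟩ := exists_steps (X := Unit) h.regular hT (fun g x => b (g x))
  obtain ⟨α, hα⟩ := exists_forall_lt_fun hregκ (fun ζ => a (g ζ ())) (by rwa [card_Pt])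
  obtain ⟨ζ, hζ⟩ := h.saturated
    (fun ζ => {i | ζ ∈ T i ∧ g ζ () i < F α i ∧ F α i < b (g ζ ()) i}) (by
      rintro ζ ξ hζξ i ⟨h1, h2, h3⟩ ⟨h4, h5, h6⟩
      exact (h3.trans_le (hg ζ ξ hζξ () i h1)).not_gt h5)
  refine hDI (g ζ ()) _ hζ ?_
  have h1 : ∀ᶠ i in (D (g ζ ()) : Filter ι), ζ ∈ T i := (hDI _).le_dual (eventually_dual.2 (hTI ζ))
  have h2 : ModLT (D (g ζ ()) : Filter ι) (g ζ ()) (F α) :=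
    (hga (g ζ ())).trans_le ((hDJ _).le_dual (hF _ _ (hα ζ).le))
  have h3 := hFb (g ζ ()) α
  filter_upwards [h1, h2, h3] with i a b c using ⟨a, b, c⟩

end

section

variable {ι : Type u} {lam : ι → Cardinal.{u}} {I K : Order.Ideal (Set ι)} {θ μ : Cardinal.{u}}

/-! ### Increasing sequences -/

/-- The sequence `f` of length `μ` is strictly increasing modulo the ideal `K`. -/
def Increasing (K : Order.Ideal (Set ι)) (f : Pt μ → Product lam) : Prop :=
  ∀ α β, α < β → ModLT (dual K) (f α) (f β)

theorem Increasing.modLE {f : Pt μ → Product lam} (hf : Increasing K f) {α β : Pt μ}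
    (h : α ≤ β) : ModLE (dual K) (f α) (f β) := by
  rcases h.eq_or_lt with rfl | h
  · exact modLE_refl _
  · exact (hf _ _ h).le

/-- Above every sequence there is an increasing one that bounds, at each `α`, the listed
subsequences of its initial segment. -/
theorem exists_obedient (hreg : ∀ i, (lam i).IsRegular)
    (hdir : Directed (dual K) lam μ) {Y : Type u} {T : ι → Set Y}
    (hT : ∀ i, #(T i) < lam i) {R : Pt μ → Type u} (hR : ∀ α, #(R α) < μ)
    (Q : ∀ α, R α → Y → Pt μ) (f₀ : Pt μ → Product lam) :
    ∃ f : Pt μ → Product lam, (∀ α i, f₀ α i ≤ f α i) ∧ Increasing K f ∧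
      ∀ α τ, ∀ᶠ i in dual K, ∀ x ∈ T i, Q α τ x < α → f (Q α τ x) i ≤ f α i := by
  obtain ⟨f, hf⟩ := exists_wf_rec (L := Pt μ) (X := Product lam)
    (fun α F b => (∀ i, f₀ α i ≤ b i) ∧ (∀ β h, ModLT (dual K) (F β h) b) ∧
      ∀ τ, ∀ᶠ i in dual K, ∀ x ∈ T i, ∀ h : Q α τ x < α, F _ h i ≤ b i) (by
      intro α F
      obtain ⟨g₁, hg₁⟩ := hdir.exists_gt hreg (card_Iio_lt α) fun β : Iio α => F β.1 β.2
      -- Each list is bounded pointwise over its live entries; the fewer than μ resulting bounds are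
      -- then joined modulo the ideal.
      have : ∀ (τ : R α) (i : ι), ∃ b : Pt (lam i), ∀ x : {x : T i // Q α τ x < α},
          F (Q α τ x.1) x.2 i < b := fun τ i =>
        exists_forall_lt_fun (hreg i) _ ((mk_subtype_le _).trans_lt (hT i))
      choose b hb using this
      obtain ⟨g₂, hg₂⟩ := hdir.exists_gt hreg (hR α) b
      refine ⟨fun i => max (f₀ α i) (max (g₁ i) (g₂ i)), fun i => le_max_left _ _,
        fun β h => ?_, fun τ => ?_⟩
      · exact (hg₁ ⟨β, h⟩).trans_le (Filter.Eventually.of_forall fun i =>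
          (le_max_left _ _).trans (le_max_right _ _))
      · filter_upwards [hg₂ τ] with i hi x hx h
        exact ((hb τ i ⟨⟨x, hx⟩, h⟩).trans hi).le.trans ((le_max_right _ _).trans (le_max_right _ _)))
  exact ⟨f, fun α => (hf α).1, fun α β h => (hf β).2.1 α h, fun α => (hf α).2.2⟩

theorem exists_increasing_ge (hreg : ∀ i, (lam i).IsRegular) (hμ : μ ≠ 0)
    (hdir : Directed (dual K) lam μ) (f₀ : Pt μ → Product lam) :
    ∃ f : Pt μ → Product lam, (∀ α i, f₀ α i ≤ f α i) ∧ Increasing K f := by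
  -- With no lists to obey, only monotonicity remains.
  obtain ⟨f, h1, h2, -⟩ := exists_obedient hreg hdir (Y := PUnit) (T := fun _ => ∅)
    (fun i => by simpa using (hreg i).pos) (R := fun _ => PEmpty)
    (fun α => by simpa using hμ.bot_lt) (fun _ τ => τ.elim) f₀
  exact ⟨f, h1, h2⟩

/-- The sequence `f` is cofinal modulo every ultrafilter with true cofinality `μ`. -/
def Universal (I : Order.Ideal (Set ι)) (f : Pt μ → Product lam) : Prop :=
  ∀ D : Ultrafilter ι, DisjointTo D I → tcf (D : Filter ι) lam = μ →
    ∀ q, ∃ α, ModLE (D : Filter ι) q (f α)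

/-- Otherwise each `f` is bounded, by `b f`, modulo an ultrafilter with a scale `p f`. Iterate `p`,
and let `t` bound all the `b (G ζ)` modulo I: at a late stage `t` is caught between `G ζ` and `p (G
ζ)`, for different `ζ` on disjoint sets. -/
theorem Basic.exists_universal (h : Basic I lam θ) (hμ : μ.IsRegular) (hθμ : θ < μ) :
    ∃ f : Pt μ → Product lam, Universal I f := by
  by_contra! hcon
  have hΘ : #(Pt θ) < μ := by rwa [card_Pt]
  choose inc hinc_ge hinc using
    exists_increasing_ge (K := J I lam μ) h.regular hμ.ne_zero (h.directed_J μ)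
  have hstep : ∀ f : Pt μ → Product lam, ∃ (D : Ultrafilter ι) (b : Product lam)
      (p : Pt μ → Product lam), DisjointTo D I ∧ (∀ α, ModLT (D : Filter ι) (inc f α) b) ∧
      (∀ α β, α < β → ModLT (D : Filter ι) (p α) (p β)) ∧
      ∀ q, ∃ α, ModLE (D : Filter ι) q (p α) := by
    intro f
    have := hcon (inc f)
    unfold Universal at this
    push Not at this
    obtain ⟨D, hD, htcf, b, hb⟩ := this
    have hs := tcf_mem_scaleLengths D lam
    rw [htcf] at hs
    obtain ⟨p, hp, hc⟩ := hs
    exact ⟨D, b, p, hD, fun α => modLT_of_not_modLE (hb α), hp, hc⟩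
  choose D b p hD hb hp hc using hstep
  obtain ⟨T, hT, hTI⟩ := h.live
  obtain ⟨G, hG⟩ := exists_steps h.regular hT p
  obtain ⟨t, ht⟩ := h.directed.exists_gt h.regular
    (by rw [card_Pt]; exact Order.lt_succ θ) fun ζ => b (G ζ)
  choose a ha using fun ζ => hc (G ζ) t
  obtain ⟨α, hα⟩ := exists_forall_lt_fun hμ a hΘ
  obtain ⟨ζ, hζ⟩ := h.saturated
    (fun ζ => {i | ζ ∈ T i ∧ inc (G ζ) α i < b (G ζ) i ∧ b (G ζ) i < t i ∧ t i ≤ p (G ζ) α i}) (by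
      rintro ζ ξ hζξ i ⟨h1, -, -, h4⟩ ⟨-, h6, h7, -⟩
      exact ((h6.trans h7).trans_le h4).not_ge
        ((hG ζ ξ hζξ α i h1).trans (hinc_ge (G ξ) α i)))
  refine hD (G ζ) _ hζ ?_
  have h1 : ∀ᶠ i in (D (G ζ) : Filter ι), ζ ∈ T i := (hD _).le_dual (eventually_dual.2 (hTI ζ))
  have h2 := hb (G ζ) α
  have h3 := (hD (G ζ)).le_dual (ht ζ)
  have h4 := (ha ζ).trans (hp _ _ _ (hα ζ)).le
  filter_upwards [h1, h2, h3, h4] with i a b c d using ⟨a, b, c, d⟩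

/-- The function `g` bounds `f` modulo every ultrafilter disjoint to `K` modulo which `f` is
bounded. -/
def Bounding (K : Order.Ideal (Set ι)) (f : Pt μ → Product lam) (g : Product lam) : Prop :=
  ∀ D : Ultrafilter ι, DisjointTo D K → (∃ b, ∀ α, ModLT (D : Filter ι) (f α) b) →
    ∀ α, ModLT (D : Filter ι) (f α) g

theorem Basic.exists_bounding (h : Basic I lam θ) (hIK : I ≤ K) (hμ : μ.IsRegular) (hθμ : θ < μ)
    {f : Pt μ → Product lam} (hf : Increasing K f) : ∃ g, Bounding K f g := by
  by_contra! hcon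
  have hstep : ∀ g : Product lam, ∃ (D : Ultrafilter ι) (b : Product lam) (α : Pt μ),
      DisjointTo D K ∧ (∀ α, ModLT (D : Filter ι) (f α) b) ∧ ModLE (D : Filter ι) g (f α) := by
    intro g
    have := hcon g
    unfold Bounding at this
    push Not at this
    obtain ⟨D, hD, ⟨b, hb⟩, α, hα⟩ := this
    refine ⟨D, b, α, hD, hb, ?_⟩
    have := Ultrafilter.eventually_not.2 hα
    exact this.mono fun _ => not_lt.1
  choose D b a hD hb ha using hstep
  obtain ⟨T, hT, hTI⟩ := h.live
  obtain ⟨g, hg⟩ := exists_steps (X := Unit) h.regular hT (fun g x => b (g x))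
  obtain ⟨α, hα⟩ := exists_forall_lt_fun hμ (fun ζ => a (g ζ ())) (by rwa [card_Pt])
  obtain ⟨ζ, hζ⟩ := h.saturated
    (fun ζ => {i | ζ ∈ T i ∧ g ζ () i ≤ f α i ∧ f α i < b (g ζ ()) i}) (by
      rintro ζ ξ hζξ i ⟨h1, -, h3⟩ ⟨-, h5, -⟩
      exact (h3.trans_le (hg ζ ξ hζξ () i h1)).not_ge h5)
  refine hD (g ζ ()) _ (hIK hζ) ?_
  have h1 : ∀ᶠ i in (D (g ζ ()) : Filter ι), ζ ∈ T i :=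
    (hD _).le_dual (eventually_dual.2 (hIK (hTI ζ)))
  have h2 := (ha (g ζ ())).trans ((hD _).le_dual (hf.modLE (hα ζ).le))
  have h3 := hb (g ζ ()) α
  filter_upwards [h1, h2, h3] with i a b c using ⟨a, b, c⟩

/-! ### Weak generators -/

/-- The set where `g` has been passed by the sequence `f` at stage `α`. -/
def passed (f : Pt μ → Product lam) (g : Product lam) (α : Pt μ) : Set ι := {i | g i ≤ f α i}

section Generators

variable {f : Pt μ → Product lam} {g : Product lam}

theorem Increasing.passed_sdiff (hf : Increasing K f) {α β : Pt μ} (h : α ≤ β) :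
    passed f g α \ passed f g β ∈ K := by
  have : {i | ¬ f α i ≤ f β i} ∈ K := eventually_dual.1 (hf.modLE h)
  exact K.lower (fun i hi hle => hi.2 (le_trans (b := f α i) hi.1 hle)) this

/-- If `f` were bounded modulo `D`, then `g` would bound it strictly, although `f α` has passed `g`.
Being unbounded, `f` is cofinal by linearity. -/
theorem Bounding.cofinal (hg : Bounding K f g) {D : Ultrafilter ι} (hD : DisjointTo D K)
    {α : Pt μ} (hα : passed f g α ∈ D) (q : Product lam) :
    ∃ β, ModLE (D : Filter ι) q (f β) := by
  by_contra! hcon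
  have := hg D hD ⟨q, fun β => modLT_of_not_modLE (hcon β)⟩ α
  obtain ⟨i, hi, hi'⟩ := (this.and hα).exists
  exact hi.not_ge hi'

theorem passed_mem_Jle (hμ : μ.IsRegular) (hf : Increasing (J I lam μ) f)
    (hg : Bounding (J I lam μ) f g) (α : Pt μ) : passed f g α ∈ Jle I lam μ := by
  rw [mem_Jle]
  intro D hD hα
  by_contra! hlt
  have hDJ := hD.J hlt.le
  rw [tcf_eq_of_scale hμ f (fun α β h => hDJ.le_dual (hf α β h)) (hg.cofinal hDJ hα)] at hlt
  exact hlt.false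

theorem Universal.exists_passed_mem (hu : Universal I f) {D : Ultrafilter ι}
    (hD : DisjointTo D I) (ht : tcf (D : Filter ι) lam = μ) : ∃ α, passed f g α ∈ D :=
  hu D hD ht g

/-- The scale is `f` restricted. If some `q'` were never bounded, the set would stay positive after
adjoining all {i : q' i ≤ f β i} to the ideal, and an ultrafilter avoiding these contradicts
cofinality of `f`. -/
theorem hasTcfOn_passed (hμ : μ.IsRegular) (hf : Increasing K f) (hg : Bounding K f g) {α : Pt μ}
    (hα : passed f g α ∉ K) : HasTcfOn K lam (passed f g α) μ := by
  classical
  have := comap_dual_neBot hα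
  refine hasTcf_of_scale hμ (fun β i => f β i) (fun β γ h => ?_) (fun q => ?_)
  · exact (Filter.tendsto_comap).eventually (hf β γ h)
  let q' : Product lam := fun i => if h : i ∈ passed f g α then q ⟨i, h⟩ else f α i
  have hq' : ∀ i : passed f g α, q' i = q i := fun i => by simp [q']
  by_contra! hcon
  have hpos : ∀ β, {i | ¬ q' i ≤ f β i} ∩ passed f g α ∉ K := by
    intro β hβ
    refine hcon β ((eventually_comap_dual.2 hβ).mono fun i hi => ?_)
    rwa [hq'] at hi
  obtain ⟨D, hD, hαD⟩ := exists_disjointTo (A := passed f g α)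
    (K := plus K {A | ∃ β, A = {i | q' i ≤ f β i}}) (by
      rintro ⟨s, hs, hs𝓑, hA⟩
      have : ∃ β, ⋃₀ s \ {i | q' i ≤ f β i} ∈ K := by
        clear hA
        induction s, hs using Set.Finite.induction_on with
        | empty => exact ⟨α, K.lower (by simp) K.nonempty.choose_spec⟩
        | @insert A s _ _ ih =>
          obtain ⟨β, hβ⟩ := ih ((subset_insert _ _).trans hs𝓑)
          obtain ⟨γ, rfl⟩ := hs𝓑 (mem_insert _ _)
          have hmono : ∀ δ ≤ max β γ, {i | ¬ f δ i ≤ f (max β γ) i} ∈ K :=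
            fun δ hδ => eventually_dual.1 (hf.modLE hδ)
          refine ⟨max β γ, K.lower ?_ (union_mem hβ (union_mem (hmono β (le_max_left _ _))
            (hmono γ (le_max_right _ _))))⟩
          rw [sUnion_insert]
          rintro i ⟨hi | hi, hn⟩
          · exact Or.inr (Or.inr fun hle => hn (le_trans hi hle))
          · by_cases hiβ : q' i ≤ f β i
            · exact Or.inr (Or.inl fun hle => hn (le_trans hiβ hle))
            · exact Or.inl ⟨hi, hiβ⟩
      obtain ⟨β, hβ⟩ := this
      refine hpos β (K.lower ?_ (union_mem hA hβ))
      rintro i ⟨h1, h2⟩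
      by_cases hi : i ∈ ⋃₀ s
      · exact Or.inr ⟨hi, h1⟩
      · exact Or.inl ⟨h2, hi⟩)
  obtain ⟨β, hβ⟩ := hg.cofinal (hD.of_le le_plus) hαD q'
  exact hD _ (subset_plus ⟨β, rfl⟩) hβ

end Generators

theorem J_eq_plus {𝓑 : Cardinal.{u} → Set (Set ι)}
    (h₁ : ∀ ν ∈ pcf I lam, ∀ B ∈ 𝓑 ν, B ∈ Jle I lam ν)
    (h₂ : ∀ D : Ultrafilter ι, DisjointTo D I → ∃ B ∈ 𝓑 (tcf (D : Filter ι) lam), B ∈ D)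
    (μ : Cardinal.{u}) :
    J I lam μ = plus I {A | ∃ ν ∈ pcf I lam, ν < μ ∧ A ∈ 𝓑 ν} := by
  apply le_antisymm
  · intro A hA
    by_contra hcon
    obtain ⟨D, hD, hAD⟩ := exists_disjointTo hcon
    have hDI : DisjointTo D I := hD.of_le le_plus
    obtain ⟨B, hB, hBD⟩ := h₂ D hDI
    exact hD B (subset_plus ⟨_, ⟨D, hDI, rfl⟩, mem_J.1 hA D hDI hAD, hB⟩) hBD
  · refine plus_le le_J ?_
    rintro B ⟨ν, hν, hlt, hB⟩
    exact J_mono (Order.succ_le_of_lt hlt) (h₁ ν hν B hB)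

theorem Jle_eq_plus (hreg : ∀ i, (lam i).IsRegular) (hdir : Directed (dual (J I lam μ)) lam μ)
    {B : Set ι} (hB : B ∈ Jle I lam μ)
    (hD : ∀ D : Ultrafilter ι, DisjointTo D I → tcf (D : Filter ι) lam = μ → B ∈ D) :
    Jle I lam μ = plus (J I lam μ) {B} := by
  apply le_antisymm
  · intro A hA
    by_contra hcon
    obtain ⟨D, hDp, hAD⟩ := exists_disjointTo hcon
    have hDJ : DisjointTo D (J I lam μ) := hDp.of_le le_plus
    have hDI : DisjointTo D I := hDJ.of_le le_J
    exact hDp B (subset_plus rfl)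
      (hD D hDI ((mem_Jle.1 hA D hDI hAD).antisymm (le_tcf_of_directed hreg hdir hDJ)))
  · refine plus_le (J_mono (Order.le_succ μ)) ?_
    rintro _ rfl
    exact hB

theorem Basic.lt_of_mem_pcf (h : Basic I lam θ) (hμ : μ ∈ pcf I lam) : θ < μ := by
  obtain ⟨D, hD, rfl⟩ := hμ
  exact Order.succ_le_iff.1 (le_tcf_of_directed h.regular h.directed hD)

theorem isRegular_of_mem_pcf (hreg : ∀ i, (lam i).IsRegular) (hμ : μ ∈ pcf I lam) :
    μ.IsRegular := by
  obtain ⟨D, -, rfl⟩ := hμ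
  exact isRegular_tcf hreg D

theorem Basic.exists_weak_generators (h : Basic I lam θ) (hμ : μ ∈ pcf I lam) :
    ∃ B : Pt μ → Set ι, (∀ α β, α < β → B α \ B β ∈ J I lam μ) ∧
      (∀ α, B α ∈ Jle I lam μ) ∧
      (∀ D : Ultrafilter ι, DisjointTo D I → tcf (D : Filter ι) lam = μ → ∃ α, B α ∈ D) ∧
      ∀ α, HasTcfOn (J I lam μ) lam (B α) μ := by
  have hreg := isRegular_of_mem_pcf h.regular hμ
  have hθ := h.lt_of_mem_pcf hμ
  obtain ⟨f₀, hf₀⟩ := h.exists_universal hreg hθ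
  obtain ⟨f, hle, hf⟩ := exists_increasing_ge h.regular hreg.ne_zero (h.directed_J μ) f₀
  have hu : Universal I f := fun D hD ht q => by
    obtain ⟨α, hα⟩ := hf₀ D hD ht q
    exact ⟨α, hα.trans (Filter.Eventually.of_forall (hle α))⟩
  obtain ⟨g, hg⟩ := h.exists_bounding le_J hreg hθ hf
  obtain ⟨D₀, hD₀, ht₀⟩ := hμ
  obtain ⟨α₀, hα₀⟩ := hu.exists_passed_mem (g := g) hD₀ ht₀
  have hα₀J : passed f g α₀ ∉ J I lam μ := notMem_of_mem (hD₀.J ht₀.ge) hα₀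
  -- Starting at `α₀` makes every set J_{<μ}-positive, so that the restricted ideal is proper.
  refine ⟨fun α => passed f g (max α α₀), fun α β hαβ => ?_, fun α => ?_, fun D hD ht => ?_,
    fun α => ?_⟩
  · exact hf.passed_sdiff (max_le_max_right _ hαβ.le)
  · exact passed_mem_Jle hreg hf hg _
  · obtain ⟨α, hα⟩ := hu.exists_passed_mem (g := g) hD ht
    refine ⟨α, ?_⟩
    have := (hD.J ht.ge).le_dual (hf.modLE (le_max_left α α₀))
    filter_upwards [hα, this] with i hi hi' using le_trans hi hi'
  · refine hasTcfOn_passed hreg hf hg fun hmem => hα₀J ?_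
    exact (J I lam μ).lower (subset_sdiff_union _ _)
      (union_mem (hf.passed_sdiff (le_max_right α α₀)) hmem)

theorem Basic.weakPcfTheorem (h : Basic I lam θ) : WeakPcfTheorem I lam (Order.succ θ) := by
  refine ⟨h.directed, h.directed_J, ?_⟩
  have : ∀ μ, ∃ B : Pt μ → Set ι, μ ∈ pcf I lam → (∀ α β, α < β → B α \ B β ∈ J I lam μ) ∧
      (∀ α, B α ∈ Jle I lam μ) ∧
      (∀ D : Ultrafilter ι, DisjointTo D I → tcf (D : Filter ι) lam = μ → ∃ α, B α ∈ D) ∧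
      ∀ α, HasTcfOn (J I lam μ) lam (B α) μ := by
    intro μ
    by_cases hμ : μ ∈ pcf I lam
    · obtain ⟨B, hB⟩ := h.exists_weak_generators hμ
      exact ⟨B, fun _ => hB⟩
    · exact ⟨fun _ => ∅, fun h => absurd h hμ⟩
  choose B hB using this
  refine ⟨B, fun μ hμ => (hB μ hμ).1, J_eq_plus (𝓑 := fun ν => {A | ∃ α, A = B ν α}) ?_ ?_,
    fun μ hμ => (hB μ hμ).2.2.2⟩
  · rintro ν hν _ ⟨α, rfl⟩
    exact (hB ν hν).2.1 α
  · intro D hD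
    obtain ⟨α, hα⟩ := (hB _ ⟨D, hD, rfl⟩).2.2.1 D hD rfl
    exact ⟨_, ⟨α, rfl⟩, hα⟩

end

section

variable {ι : Type u} {lam : ι → Cardinal.{u}} {I K : Order.Ideal (Set ι)} {θ μ : Cardinal.{u}}

/-! ### Generators -/

/-- Along sequences of length `θ`, inside any club, the sequence `f` increases pointwise up to an
error that depends on one index at a time. -/
def SteadilyIncreasing (K : Order.Ideal (Set ι)) (θ : Cardinal.{u}) (f : Pt μ → Product lam) :
    Prop :=
  ∀ s : Pt μ → Pt μ, ∃ (q : Pt θ → Pt μ) (N : Pt θ → Set ι), (∀ ζ, N ζ ∈ dual K) ∧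
    ∀ ζ ξ, ζ < ξ → ∀ i ∈ N ζ, i ∈ N ξ → f (s (q ζ)) i ≤ f (q ξ) i

theorem Increasing.steadilyIncreasing_of_lt_aleph0 {f : Pt μ → Product lam}
    (hf : Increasing K f) (hμ : μ.IsRegular) (hθ : θ < ℵ₀) : SteadilyIncreasing K θ f := by
  intro s
  obtain ⟨q, hq⟩ := exists_climbing hμ (X := Pt θ) (by rw [card_Pt]; exact hθ.trans_le hμ.1) s
  have : Finite (Pt θ) := by rwa [← lt_aleph0_iff_finite, card_Pt]
  refine ⟨q, fun _ => {i | ∀ ζ ξ, ζ < ξ → f (s (q ζ)) i ≤ f (q ξ) i}, fun _ => ?_,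
    fun ζ ξ h i hi _ => hi ζ ξ h⟩
  refine Filter.eventually_all.2 fun ζ => Filter.eventually_all.2 fun ξ => ?_
  by_cases h : ζ < ξ
  · exact (hf _ _ (hq ζ ξ h).2).mono fun i hi _ => hi.le
  · exact Filter.Eventually.of_forall fun i h' => absurd h' h

theorem Basic.exists_steadilyIncreasing (h : Basic I lam θ) (hμ : μ.IsRegular)
    (happ : ℵ₀ ≤ θ → Approachable μ θ) (f₀ : Pt μ → Product lam) :
    ∃ f : Pt μ → Product lam, (∀ α i, f₀ α i ≤ f α i) ∧ Increasing (J I lam μ) f ∧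
      SteadilyIncreasing (J I lam μ) θ f := by
  rcases lt_or_ge θ ℵ₀ with hθ | hθ
  · obtain ⟨f, hle, hf⟩ := exists_increasing_ge h.regular hμ.ne_zero (h.directed_J μ) f₀
    exact ⟨f, hle, hf, hf.steadilyIncreasing_of_lt_aleph0 hμ hθ⟩
  obtain ⟨R, Q, hR, hQ⟩ := happ hθ
  obtain ⟨T, hT, hTI⟩ := h.live
  obtain ⟨f, hle, hf, hob⟩ := exists_obedient h.regular (h.directed_J μ) hT hR Q f₀
  refine ⟨f, hle, hf, fun s => ?_⟩
  obtain ⟨q, e, hq, hτ⟩ := hQ s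
  choose τ hτ using hτ
  have : NoMaxOrder (Pt θ) := Cardinal.noMaxOrder hθ
  -- For ζ < ξ the comparison runs through `q (succ ζ)`: the first clause at `ζ` reaches it, and
  -- obedience at `q ξ` goes on from there, the entry being live by the second clause at `ζ`. Every
  -- clause thus involves one index only.
  refine ⟨q, fun ζ => {i | f (s (q ζ)) i ≤ f (q (Order.succ ζ)) i ∧ e (Order.succ ζ) ∈ T i ∧
    ∀ x ∈ T i, Q (q ζ) (τ ζ) x < q ζ → f (Q (q ζ) (τ ζ) x) i ≤ f (q ζ) i}, fun ζ => ?_, ?_⟩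
  · have h1 := hf.modLE (hq ζ _ (Order.lt_succ ζ)).2
    have h2 : ∀ᶠ i in dual (J I lam μ), e (Order.succ ζ) ∈ T i :=
      eventually_dual.2 (le_J (hTI _))
    filter_upwards [h1, h2, hob (q ζ) (τ ζ)] with i a b c using ⟨a, b, c⟩
  · rintro ζ ξ hζξ i ⟨h1, h2, -⟩ ⟨-, -, h3⟩
    rcases (Order.succ_le_of_lt hζξ).eq_or_lt with heq | hlt
    · rwa [heq] at h1
    · have := h3 _ h2
      rw [hτ ξ _ hlt] at this
      exact h1.trans (this (hq _ _ hlt).1)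

/-- Otherwise each stage `α` has a stage `s α` adding a positive increment. Along the steady
sequence what has been passed at `s (q ζ)` is still passed at `q ξ`, so the increments are disjoint
inside the sets `N ζ`, against saturation. -/
theorem Basic.exists_stable (h : Basic I lam θ) (hIK : I ≤ K) {f : Pt μ → Product lam}
    (hs : SteadilyIncreasing K θ f) (g : Product lam) :
    ∃ α, ∀ β, passed f g β \ passed f g α ∈ K := by
  by_contra! hcon
  choose s hs' using hcon
  obtain ⟨q, N, hN, hq⟩ := hs s
  obtain ⟨ζ, hζ⟩ := h.saturated
    (fun ζ => N ζ ∩ (passed f g (s (q ζ)) \ passed f g (q ζ))) (by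
      rintro ζ ξ hζξ i ⟨h1, h2, -⟩ ⟨h3, -, h4⟩
      exact h4 (le_trans (b := f (s (q ζ)) i) h2 (hq ζ ξ hζξ i h1 h3)))
  refine hs' (q ζ) (K.lower ?_ (union_mem (hIK hζ) (mem_dual.1 (hN ζ))))
  intro i hi
  by_cases hiN : i ∈ N ζ
  · exact Or.inl ⟨hiN, hi⟩
  · exact Or.inr hiN

theorem Basic.exists_generator (h : Basic I lam θ) (hμ : μ ∈ pcf I lam)
    (happ : ℵ₀ ≤ θ → Approachable μ θ) :
    ∃ B : Set ι, B ∉ J I lam μ ∧ B ∈ Jle I lam μ ∧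
      (∀ D : Ultrafilter ι, DisjointTo D I → tcf (D : Filter ι) lam = μ → B ∈ D) ∧
      HasTcfOn (J I lam μ) lam B μ := by
  have hreg := isRegular_of_mem_pcf h.regular hμ
  have hθ := h.lt_of_mem_pcf hμ
  obtain ⟨f₀, hf₀⟩ := h.exists_universal hreg hθ
  obtain ⟨f, hle, hf, hs⟩ := h.exists_steadilyIncreasing hreg happ f₀
  have hu : Universal I f := fun D hD ht q => by
    obtain ⟨α, hα⟩ := hf₀ D hD ht q
    exact ⟨α, hα.trans (Filter.Eventually.of_forall (hle α))⟩
  obtain ⟨g, hg⟩ := h.exists_bounding le_J hreg hθ hf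
  obtain ⟨α, hα⟩ := h.exists_stable le_J hs g
  have hmem : ∀ D : Ultrafilter ι, DisjointTo D I → tcf (D : Filter ι) lam = μ →
      passed f g α ∈ D := by
    intro D hD ht
    obtain ⟨β, hβ⟩ := hu.exists_passed_mem (g := g) hD ht
    rcases Ultrafilter.union_mem_iff.1 (Filter.mem_of_superset hβ
      (subset_sdiff_union _ (passed f g α))) with h' | h'
    · exact absurd h' (hD.J ht.ge _ (hα β))
    · exact h'
  have hpos : passed f g α ∉ J I lam μ := by
    obtain ⟨D, hD, ht⟩ := hμ
    exact notMem_of_mem (hD.J ht.ge) (hmem D hD ht)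
  exact ⟨passed f g α, hpos, passed_mem_Jle hreg hf hg α, hmem, hasTcfOn_passed hreg hf hg hpos⟩

theorem Basic.pcfTheorem (h : Basic I lam θ)
    (happ : ∀ μ ∈ pcf I lam, ℵ₀ ≤ θ → Approachable μ θ) : PcfTheorem I lam (Order.succ θ) := by
  refine ⟨h.directed, h.directed_J, ?_⟩
  have : ∀ μ, ∃ B : Set ι, μ ∈ pcf I lam → B ∉ J I lam μ ∧ B ∈ Jle I lam μ ∧
      (∀ D : Ultrafilter ι, DisjointTo D I → tcf (D : Filter ι) lam = μ → B ∈ D) ∧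
      HasTcfOn (J I lam μ) lam B μ := by
    intro μ
    by_cases hμ : μ ∈ pcf I lam
    · obtain ⟨B, hB⟩ := h.exists_generator hμ (happ μ hμ)
      exact ⟨B, fun _ => hB⟩
    · exact ⟨∅, fun h => absurd h hμ⟩
  choose B hB using this
  refine ⟨B, J_eq_plus (𝓑 := fun ν => {A | A = B ν}) ?_ ?_, fun μ hμ => ?_⟩
  · rintro ν hν _ rfl
    exact (hB ν hν).2.1
  · intro D hD
    exact ⟨_, rfl, (hB _ ⟨D, hD, rfl⟩).2.2.1 D hD rfl⟩
  · obtain ⟨h1, h2, h3, h4⟩ := hB μ hμ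
    exact ⟨h1, h4, Jle_eq_plus h.regular (h.directed_J μ) h2 h3⟩

/-- Members of pcf are at least θ⁺. The first two alternatives exclude θ⁺ itself, which is the only
case in need of the continuity condition. -/
theorem Basic.approachable_of_mem_pcf (h : Basic I lam θ)
    (hc : (∀ i, Order.succ θ < lam i) ∨
      Directed (dual I) lam (Order.succ (Order.succ θ)) ∨
      ExistsContinuityCondition (Order.succ θ) θ) (hμ : μ ∈ pcf I lam) (hθ : ℵ₀ ≤ θ) :
    Approachable μ θ := by
  have hreg := isRegular_of_mem_pcf h.regular hμ
  have key : Directed (dual I) lam (Order.succ (Order.succ θ)) → Approachable μ θ := by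
    intro hdir
    obtain ⟨D, hD, rfl⟩ := hμ
    exact approachable hθ hreg (le_tcf_of_directed h.regular hdir hD)
  rcases hc with hc | hc | hc
  · exact key (directed_of_lt h.regular hc _)
  · exact key hc
  · rcases (Order.succ_le_of_lt (h.lt_of_mem_pcf hμ)).eq_or_lt with rfl | hlt
    · exact approachable_of_continuityCondition hc
    · exact approachable hθ hreg (Order.succ_le_of_lt hlt)

end

end PcfTh

theorem claim2p12 {ι : Type u} (I : Order.Ideal (Set ι)) (hI : (Set.univ : Set ι) ∉ I)
    (lam : ι → Cardinal.{u}) (θ : Cardinal.{u}) :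
    (PcfTh.BasicAssumption I lam θ → PcfTh.WeakPcfTheorem I lam (Order.succ θ)) ∧
    (PcfTh.BasicAssumption I lam θ →
      ((∀ i, Order.succ θ < lam i) ∨
        PcfTh.Directed (PcfTh.dual I) lam (Order.succ (Order.succ θ)) ∨
        PcfTh.ExistsContinuityCondition (Order.succ θ) θ) →
      PcfTh.PcfTheorem I lam (Order.succ θ)) ∧
    ((∀ i, (lam i).IsRegular) →
      (PcfTh.PcfTheorem I lam θ → PcfTh.WeakPcfTheorem I lam θ) ∧
      (PcfTh.WeakPcfTheorem I lam θ → PcfTh.WeakerPcfTheorem I lam θ) ∧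
      (PcfTh.WeakerPcfTheorem I lam θ → PcfTh.WeakestPcfTheorem I lam θ)) :=
  ⟨fun h => h.basic.weakPcfTheorem,
    fun h hc => h.basic.pcfTheorem fun _ hμ => h.basic.approachable_of_mem_pcf hc hμ,
    fun hreg => ⟨fun h => h.weakPcfTheorem hreg, fun h => h.weakerPcfTheorem hreg,
      fun h => h.weakestPcfTheorem⟩⟩
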